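/- **Lemma 2.1.** All Cayley graphs below are taken with respect to finite generating sets. A graph has *finite tree-width* if, for some $k\in\mathbb N$, it has a tree-decomposition (over a possibly infinite tree) all of whose bags have at most $k+1$ vertices. A *ray* is a one-way infinite path; two rays are *equivalent* if they are connected by infinitely many pairwise disjoint finite paths; an *end* of a graph is an equivalence class of rays, and it is *thick* if it contains an infinite set of pairwise disjoint rays (disjoint always means vertex-disjoint). Let $G$ be a finitely generated group. Then every Cayley graph of $G$ that does not have finite tree-width has a thick end. In particular, if $G$ does not have finite tree-width (that is, not all of its Cayley graphs have finite tree-width), then $G$ has a thick end (that is, at least one of its Cayley graphs has a thick end). -/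

import Mathlib

namespace SimpleGraph

universe u

variable {V : Type u}

/-- A tree-decomposition of `H`: a tree `tree` (possibly infinite) with a set `bag t` of vertices
of `H` for every node `t`, such that every vertex and every edge of `H` lies in some bag, and
`bag t₁ ∩ bag t₃ ⊆ bag t₂` whenever `t₂` lies on the path from `t₁` to `t₃` in the tree. -/
structure TreeDecomposition (H : SimpleGraph V) where
  Node : Type u
  tree : SimpleGraph Node
  isTree : tree.IsTree
  bag : Node → Set V
  vertex_mem : ∀ v : V, ∃ t, v ∈ bag t
  edge_mem : ∀ v w : V, H.Adj v w → ∃ t, v ∈ bag t ∧ w ∈ bag t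
  inter_subset : ∀ (t₁ t₂ t₃ : Node) (p : tree.Walk t₁ t₃), p.IsPath → t₂ ∈ p.support →
    bag t₁ ∩ bag t₃ ⊆ bag t₂

/-- `H` has finite tree-width: for some `k`, it has a tree-decomposition of width at most `k`,
i.e. with all bags of size at most `k + 1`. -/
def HasFiniteTreeWidth (H : SimpleGraph V) : Prop :=
  ∃ (k : ℕ) (D : TreeDecomposition H), ∀ t : D.Node, (D.bag t).encard ≤ (k : ℕ∞) + 1

/-- A ray: a one-way infinite path `vert 0, vert 1, vert 2, …`, all vertices distinct. -/
structure Ray (H : SimpleGraph V) where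
  vert : ℕ → V
  injective : Function.Injective vert
  adj : ∀ n, H.Adj (vert n) (vert (n + 1))

namespace Ray

variable {H : SimpleGraph V}

/-- The vertex set of a ray. -/
def verts (R : Ray H) : Set V := Set.range R.vert

/-- `R` and `R'` are connected by infinitely many pairwise (vertex-)disjoint finite paths. -/
def Equivalent (R R' : Ray H) : Prop :=
  ∃ (a b : ℕ → ℕ) (P : ∀ n, H.Walk (R.vert (a n)) (R'.vert (b n))),
    (∀ n, (P n).IsPath) ∧
      ∀ m n, m ≠ n → Disjoint {v | v ∈ (P m).support} {v | v ∈ (P n).support}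

/-- Two rays are equivalent iff no finite vertex set meets all walks between them. -/
theorem equivalent_iff (R R' : Ray H) :
    R.Equivalent R' ↔ ∀ X : Set V, X.Finite →
      ∃ (i j : ℕ) (p : H.Walk (R.vert i) (R'.vert j)), ∀ v ∈ p.support, v ∉ X := by
  classical
  constructor
  · rintro ⟨a, b, P, -, hd⟩ X hX
    by_contra! hcon
    choose f hf hfX using fun n => hcon (a n) (b n) (P n)
    have hinj : Function.Injective f := by
      intro m n hmn
      by_contra hne
      exact Set.disjoint_left.1 (hd m n hne) (hf m) (by simpa [hmn] using hf n)
    exact Set.infinite_of_injective_forall_mem hinj hfX hX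
  · intro h
    have : Std.Symm (fun p q : Σ i j : ℕ, H.Walk (R.vert i) (R'.vert j) =>
        Disjoint {v | v ∈ p.2.2.support} {v | v ∈ q.2.2.support}) :=
      ⟨fun _ _ hpq => Disjoint.symm hpq⟩
    obtain ⟨f, hf, hfr⟩ := exists_seq_of_forall_finset_exists'
      (α := Σ i j : ℕ, H.Walk (R.vert i) (R'.vert j)) (fun p => p.2.2.IsPath)
      (fun p q => Disjoint {v | v ∈ p.2.2.support} {v | v ∈ q.2.2.support})
      (fun s _ => by
        obtain ⟨i, j, p, hp⟩ := h (⋃ q ∈ s, {v | v ∈ q.2.2.support})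
          (s.finite_toSet.biUnion fun q _ => q.2.2.support.finite_toSet)
        refine ⟨⟨i, j, p.bypass⟩, p.bypass_isPath, fun q hq => ?_⟩
        refine Set.disjoint_left.2 fun v hvq hvp => ?_
        exact hp v (p.support_bypass_subset_support hvp) (Set.mem_biUnion hq hvq))
    exact ⟨fun n => (f n).1, fun n => (f n).2.1, fun n => (f n).2.2, hf,
      fun m n hmn => hfr hmn⟩

/-- The segment of a ray between two of its vertices. -/
theorem exists_segment (R : Ray H) {j k : ℕ} (h : j ≤ k) :
    ∃ p : H.Walk (R.vert j) (R.vert k), ∀ v ∈ p.support, ∃ i, j ≤ i ∧ v = R.vert i := by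
  induction k, h using Nat.le_induction with
  | base => exact ⟨Walk.nil, fun v hv => ⟨j, le_rfl, by simpa using hv⟩⟩
  | succ k hk ih =>
    obtain ⟨p, hp⟩ := ih
    refine ⟨p.concat (R.adj k), fun v hv => ?_⟩
    rw [Walk.support_concat] at hv
    simp only [List.mem_append, List.mem_singleton] at hv
    rcases hv with hv | hv
    · exact hp v hv
    · exact ⟨k + 1, by omega, hv⟩

theorem Equivalent.refl (R : Ray H) : R.Equivalent R := by
  rw [equivalent_iff]
  intro X hX
  obtain ⟨i, hi⟩ := (hX.preimage R.injective.injOn).exists_notMem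
  exact ⟨i, i, Walk.nil, fun v hv => by
    rw [Walk.support_nil, List.mem_singleton] at hv; subst hv; exact hi⟩

theorem Equivalent.symm {R R' : Ray H} (h : R.Equivalent R') : R'.Equivalent R := by
  rw [equivalent_iff] at h ⊢
  intro X hX
  obtain ⟨i, j, p, hp⟩ := h X hX
  exact ⟨j, i, p.reverse, fun v hv => hp v (by simpa using hv)⟩

theorem Equivalent.trans {R R' R'' : Ray H} (h : R.Equivalent R') (h' : R'.Equivalent R'') :
    R.Equivalent R'' := by
  rw [equivalent_iff] at h h' ⊢
  intro X hX
  obtain ⟨N, hN⟩ := (hX.preimage R'.injective.injOn).bddAbove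
  have hXN : ∀ i, N < i → R'.vert i ∉ X := fun i hi hiX => absurd (hN hiX) (by omega)
  have hY : (X ∪ R'.vert '' Set.Iic N).Finite := hX.union ((Set.finite_Iic N).image _)
  obtain ⟨i, j, p, hp⟩ := h _ hY
  obtain ⟨k, l, q, hq⟩ := h' _ hY
  have hj : N < j := by
    by_contra hj
    exact hp _ p.end_mem_support (Or.inr ⟨j, by simpa using hj, rfl⟩)
  have hk : N < k := by
    by_contra hk
    exact hq _ q.start_mem_support (Or.inr ⟨k, by simpa using hk, rfl⟩)
  have hs : ∃ s : H.Walk (R'.vert j) (R'.vert k), ∀ v ∈ s.support, v ∉ X := by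
    rcases le_total j k with hjk | hjk
    · obtain ⟨s, hs⟩ := R'.exists_segment hjk
      refine ⟨s, fun v hv => ?_⟩
      obtain ⟨m, hm, rfl⟩ := hs v hv
      exact hXN m (by omega)
    · obtain ⟨s, hs⟩ := R'.exists_segment hjk
      refine ⟨s.reverse, fun v hv => ?_⟩
      obtain ⟨m, hm, rfl⟩ := hs v (by simpa using hv)
      exact hXN m (by omega)
  obtain ⟨s, hs⟩ := hs
  refine ⟨i, l, (p.append s).append q, fun v hv => ?_⟩
  rw [Walk.mem_support_append_iff, Walk.mem_support_append_iff] at hv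
  rcases hv with (hv | hv) | hv
  · exact fun hvX => hp v hv (Or.inl hvX)
  · exact hs v hv
  · exact fun hvX => hq v hv (Or.inl hvX)

end Ray

/-- Equivalence of rays, as an equivalence relation. -/
def raySetoid (H : SimpleGraph V) : Setoid (Ray H) where
  r := Ray.Equivalent
  iseqv := ⟨Ray.Equivalent.refl, Ray.Equivalent.symm, Ray.Equivalent.trans⟩

/-- The ends of `H`: equivalence classes of rays. -/
def RayEnd (H : SimpleGraph V) : Type u := Quotient (raySetoid H)

/-- The end that contains a given ray. -/
def Ray.toEnd {H : SimpleGraph V} (R : Ray H) : RayEnd H := Quotient.mk (raySetoid H) R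

/-- An end is thick if it contains an infinite set of pairwise (vertex-)disjoint rays. -/
def RayEnd.IsThick {H : SimpleGraph V} (ω : RayEnd H) : Prop :=
  ∃ 𝓡 : Set (Ray H), 𝓡.Infinite ∧ (∀ R ∈ 𝓡, R.toEnd = ω) ∧
    ∀ R ∈ 𝓡, ∀ R' ∈ 𝓡, R ≠ R' → Disjoint R.verts R'.verts

/-- `H` has a thick end. -/
def HasThickEnd (H : SimpleGraph V) : Prop := ∃ ω : RayEnd H, ω.IsThick

end SimpleGraph

/-- `G` has finite tree-width: all its Cayley graphs, with respect to finite generating sets, have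
finite tree-width. -/
def GroupHasFiniteTreeWidth (G : Type*) [Group G] : Prop :=
  ∀ S : Set G, S.Finite → Subgroup.closure S = ⊤ → (SimpleGraph.mulCayley S).HasFiniteTreeWidth

/-- `G` has a thick end: one of its Cayley graphs, with respect to a finite generating set, has
a thick end. -/
def GroupHasThickEnd (G : Type*) [Group G] : Prop :=
  ∃ S : Set G, S.Finite ∧ Subgroup.closure S = ⊤ ∧ (SimpleGraph.mulCayley S).HasThickEnd

/-! ### Walks confined to a vertex set. -/

namespace SimpleGraph

universe u

variable {V : Type u}

/-! Fix a vertex `o` and group the vertices at distance `n` from `o` by whether a walk at distance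
at least `n` joins them. These classes form a tree, and each class together with its parent is a bag
(`hasFiniteTreeWidth_of_levelRel`). Without finite tree-width there are therefore arbitrarily large
classes.

Call a cut tight if both its sides are connected. Only finitely many tight cuts with at most `k`
edges separate two given vertices (`finite_tightCuts`), so by vertex-transitivity the edges of such
a cut lie within a distance `D k` of each other. Hence the cut leaves at most `E k` elements of a
class on one of its sides, with `E` independent of the class (`isInseparable_levelRel`). A large
class thus behaves like a highly connected block and has a centre: for `j` up to a bound that may
grow with the class, no tight cut with at most `j` edges has a ball of radius `centerRadius D j`
about the centre inside its side poor in the class (`exists_center`). By transitivity all centres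
can be moved to `o`.

An ultrafilter at which the moved classes accumulate chooses a component `tail` of the complement of
every finite set. If few vertices cut the tail off from a large ball about `o`, so would a tight cut
with few edges (`exists_tightCut_of_disjoint_tail`); the side of the tail is rich in some class, so
the ball lies in the poor side, against the choice of the centre. So no bounded number of vertices
cuts this direction off from all finite sets. By Menger's theorem, successive minimal separators of
growing size are then linked by disjoint paths, and chains of these paths carry infinitely many
disjoint equivalent rays (`hasThickEnd_of_ultrafilter`). -/

/-- `u` and `v` are joined by a walk of `H` all of whose vertices lie in `W`. -/
def ReachableIn (H : SimpleGraph V) (W : Set V) (u v : V) : Prop :=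
  ∃ p : H.Walk u v, ∀ z ∈ p.support, z ∈ W

namespace ReachableIn

variable {H H' : SimpleGraph V} {W W' : Set V} {u v w : V}

theorem left_mem (h : H.ReachableIn W u v) : u ∈ W := h.choose_spec _ (Walk.start_mem_support _)

theorem right_mem (h : H.ReachableIn W u v) : v ∈ W := h.choose_spec _ (Walk.end_mem_support _)

theorem refl (h : u ∈ W) : H.ReachableIn W u u := ⟨Walk.nil, by simpa using h⟩

theorem symm (h : H.ReachableIn W u v) : H.ReachableIn W v u := by
  obtain ⟨p, hp⟩ := h
  exact ⟨p.reverse, fun z hz => hp z (by simpa using hz)⟩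

theorem trans (h : H.ReachableIn W u v) (h' : H.ReachableIn W v w) : H.ReachableIn W u w := by
  obtain ⟨p, hp⟩ := h
  obtain ⟨q, hq⟩ := h'
  refine ⟨p.append q, fun z hz => ?_⟩
  rw [Walk.mem_support_append_iff] at hz
  exact hz.elim (hp z) (hq z)

theorem mono (hW : W ⊆ W') (h : H.ReachableIn W u v) : H.ReachableIn W' u v :=
  h.imp fun _ hp z hz => hW (hp z hz)

theorem mono_graph (hH : H ≤ H') (h : H.ReachableIn W u v) : H'.ReachableIn W u v := by
  obtain ⟨p, hp⟩ := h
  exact ⟨p.mapLe hH, fun z hz => hp z (by simpa using hz)⟩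

theorem of_adj (h : H.Adj u v) (hu : u ∈ W) (hv : v ∈ W) : H.ReachableIn W u v :=
  ⟨h.toWalk, fun z hz => by
    simp only [Walk.support_cons, Walk.support_nil, List.mem_cons, List.not_mem_nil,
      or_false] at hz
    rcases hz with rfl | rfl <;> assumption⟩

theorem reachable (h : H.ReachableIn W u v) : H.Reachable u v := ⟨h.choose⟩

theorem head_induction {P : V → Prop} (h : H.ReachableIn W u v) (base : P v)
    (step : ∀ x y, x ∈ W → H.Adj x y → H.ReachableIn W y v → P y → P x) : P u := by
  obtain ⟨p, hp⟩ := h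
  induction p with
  | nil => exact base
  | @cons a b c hab q ih =>
    have hq : ∀ z ∈ q.support, z ∈ W := fun z hz => hp z (by simp [hz])
    exact step _ _ (hp _ (by simp)) hab ⟨q, hq⟩ (ih base step hq)

/-- A walk that leaves `S` has a first edge out of `S`. -/
theorem exists_exit {S : Set V} (h : H.ReachableIn W u v) (hu : u ∈ S) (hv : v ∉ S) :
    ∃ x y, H.ReachableIn (W ∩ S) u x ∧ H.Adj x y ∧ y ∉ S ∧ H.ReachableIn W y v := by
  revert hu
  refine h.head_induction (P := fun u => u ∈ S →
    ∃ x y, H.ReachableIn (W ∩ S) u x ∧ H.Adj x y ∧ y ∉ S ∧ H.ReachableIn W y v)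
    (fun hu => absurd hu hv) ?_
  intro a b ha hab hbv ih haS
  by_cases hb : b ∈ S
  · obtain ⟨x, y, hx, hxy⟩ := ih hb
    exact ⟨x, y, (of_adj (W := W ∩ S) hab ⟨ha, haS⟩ ⟨hbv.left_mem, hb⟩).trans hx, hxy⟩
  · exact ⟨a, b, refl ⟨ha, haS⟩, hab, hb, hbv⟩

/-- A walk that ends in `B` has an initial segment that meets `B` exactly in its last vertex. -/
theorem exists_first_hit {B : Set V} (h : H.ReachableIn W u v) (hv : v ∈ B) :
    ∃ t ∈ B, ∃ U ⊆ W, U.Finite ∧ H.ReachableIn U u t ∧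
      ∀ z ∈ U, z = t ∨ H.ReachableIn Bᶜ u z := by
  have hvW := h.right_mem
  refine h.head_induction (P := fun u => ∃ t ∈ B, ∃ U ⊆ W, U.Finite ∧ H.ReachableIn U u t ∧
      ∀ z ∈ U, z = t ∨ H.ReachableIn Bᶜ u z)
    ⟨v, hv, {v}, by simpa using hvW, Set.finite_singleton _, refl rfl, fun z hz => Or.inl hz⟩ ?_
  rintro a b ha hab - ⟨t, ht, U, hUW, hU, hbt, hUz⟩
  by_cases haB : a ∈ B
  · exact ⟨a, haB, {a}, by simpa using ha, Set.finite_singleton _, refl rfl, fun z hz => Or.inl hz⟩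
  refine ⟨t, ht, insert a U, Set.insert_subset ha hUW, hU.insert a,
    (of_adj hab (Or.inl rfl) (Or.inr hbt.left_mem)).trans (hbt.mono (Set.subset_insert _ _)), ?_⟩
  rintro z (rfl | hz)
  · exact Or.inr (refl haB)
  · refine (hUz z hz).imp_right fun h => (of_adj hab haB h.left_mem).trans h

/-- The parts of the walk before its first and after its last use of the new edge avoid that edge;
if both stop at the same end of the edge, they join up. -/
theorem fromEdgeSet_insert {E : Set (Sym2 V)} {x y : V}
    (h : (fromEdgeSet (insert s(x, y) E)).ReachableIn W u v) :
    (fromEdgeSet E).ReachableIn W u v ∨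
    ((fromEdgeSet E).ReachableIn W u x ∧ (fromEdgeSet E).ReachableIn W y v) ∨
    ((fromEdgeSet E).ReachableIn W u y ∧ (fromEdgeSet E).ReachableIn W x v) := by
  have hv := h.right_mem
  refine h.head_induction (P := fun u => (fromEdgeSet E).ReachableIn W u v ∨
    ((fromEdgeSet E).ReachableIn W u x ∧ (fromEdgeSet E).ReachableIn W y v) ∨
    ((fromEdgeSet E).ReachableIn W u y ∧ (fromEdgeSet E).ReachableIn W x v)) (Or.inl (refl hv)) ?_
  intro a b ha hab hb ih
  rw [fromEdgeSet_adj, Set.mem_insert_iff] at hab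
  obtain ⟨hab | hab, hne⟩ := hab
  · rw [Sym2.eq_iff] at hab
    rcases hab with ⟨rfl, rfl⟩ | ⟨rfl, rfl⟩
    · rcases ih with ih | ⟨-, ih⟩ | ⟨-, ih⟩
      · exact Or.inr (Or.inl ⟨refl ha, ih⟩)
      · exact Or.inr (Or.inl ⟨refl ha, ih⟩)
      · exact Or.inl ih
    · rcases ih with ih | ⟨-, ih⟩ | ⟨-, ih⟩
      · exact Or.inr (Or.inr ⟨refl ha, ih⟩)
      · exact Or.inl ih
      · exact Or.inr (Or.inr ⟨refl ha, ih⟩)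
  · have hs : (fromEdgeSet E).ReachableIn W a b :=
      of_adj ((fromEdgeSet_adj _).2 ⟨hab, hne⟩) ha hb.left_mem
    exact ih.imp hs.trans (Or.imp (And.imp_left hs.trans) (And.imp_left hs.trans))

end ReachableIn

/-! ### Menger's theorem. -/

/-- Every walk from `A` to `B` meets `Z`. -/
def Separates (H : SimpleGraph V) (Z A B : Set V) : Prop :=
  ∀ a ∈ A, ∀ b ∈ B, ¬ H.ReachableIn Zᶜ a b

/-- There are `k` pairwise disjoint vertex sets, each containing a walk from `A` to `B`. -/
def Linked (H : SimpleGraph V) (k : ℕ) (A B : Set V) : Prop :=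
  ∃ (T : Finset V) (a b : V → V) (U : V → Set V), T.card = k ∧
    (∀ t ∈ T, a t ∈ A ∧ b t ∈ B ∧ H.ReachableIn (U t) (a t) (b t)) ∧
    (T : Set V).PairwiseDisjoint U

variable {H H' : SimpleGraph V} {A B Z : Set V} {k : ℕ}

theorem Linked.symm (h : H.Linked k A B) : H.Linked k B A := by
  obtain ⟨T, a, b, U, hT, hU, hd⟩ := h
  exact ⟨T, b, a, U, hT, fun t ht => ⟨(hU t ht).2.1, (hU t ht).1, (hU t ht).2.2.symm⟩, hd⟩

theorem Linked.mono_graph (hH : H ≤ H') (h : H.Linked k A B) : H'.Linked k A B := by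
  obtain ⟨T, a, b, U, hT, hU, hd⟩ := h
  exact ⟨T, a, b, U, hT, fun t ht =>
    ⟨(hU t ht).1, (hU t ht).2.1, (hU t ht).2.2.mono_graph hH⟩, hd⟩

/-- A linkage onto a set of the same size, cut off at the first vertices in that set. -/
theorem Linked.exists_onto {B : Finset V} (h : H.Linked k A B) (hB : B.card = k) :
    ∃ (a : V → V) (U : V → Set V), (∀ t ∈ B, a t ∈ A ∧ (U t).Finite ∧
      H.ReachableIn (U t) (a t) t ∧ ∀ z ∈ U t, z = t ∨ H.ReachableIn (B : Set V)ᶜ (a t) z) ∧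
    (B : Set V).PairwiseDisjoint U := by
  classical
  obtain ⟨T, a, b, U, hT, hU, hd⟩ := h
  have := fun t (ht : t ∈ T) => (hU t ht).2.2.exists_first_hit (hU t ht).2.1
  choose! b' hb' U' hUU' hfin hreach hfirst using this
  have hinj : Set.InjOn b' T := by
    intro s hs t ht hst
    by_contra hne
    refine Set.disjoint_left.1 (hd hs ht hne) (hUU' s hs (hreach s hs).right_mem) ?_
    rw [hst]
    exact hUU' t ht (hreach t ht).right_mem
  have himg : T.image b' = B := by
    refine Finset.eq_of_subset_of_card_le (Finset.image_subset_iff.2 fun t ht => hb' t ht) ?_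
    rw [Finset.card_image_of_injOn hinj, hB, hT]
  have hsurj : ∀ s ∈ B, ∃ t ∈ T, b' t = s := fun s hs => by
    rw [← himg, Finset.mem_image] at hs
    exact hs
  choose! c hcT hc using hsurj
  refine ⟨fun s => a (c s), fun s => U' (c s), fun s hs => ⟨(hU _ (hcT s hs)).1,
    hfin _ (hcT s hs), ?_, ?_⟩, ?_⟩
  · simpa [hc s hs] using hreach _ (hcT s hs)
  · simpa [hc s hs] using hfirst _ (hcT s hs)
  · intro s hs t ht hst
    refine (hd (hcT s hs) (hcT t ht) fun h => hst ?_).mono (hUU' _ (hcT s hs)) (hUU' _ (hcT t ht))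
    rw [← hc s hs, ← hc t ht, h]

theorem Separates.exists_hit (h : H.Separates Z A B) {W : Set V} {a b : V} (ha : a ∈ A)
    (hb : b ∈ B) (hab : H.ReachableIn W a b) :
    ∃ z ∈ Z, H.ReachableIn W a z ∧ H.ReachableIn W z b := by
  by_cases haZ : a ∈ Z
  · exact ⟨a, haZ, .refl hab.left_mem, hab⟩
  by_cases hbZ : b ∈ Z
  · exact ⟨b, hbZ, hab, .refl hab.right_mem⟩
  obtain ⟨x, y, hx, hxy, hy, hyb⟩ := hab.exists_exit (S := {z | H.ReachableIn Zᶜ a z})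
    (.refl haZ) (h a ha b hb)
  have hx' := hx.mono Set.inter_subset_left
  refine ⟨y, ?_, hx'.trans (.of_adj hxy hx'.right_mem hyb.left_mem), hyb⟩
  by_contra hyZ
  have hx2 : H.ReachableIn Zᶜ a x := hx.right_mem.2
  exact hy (hx2.trans (.of_adj hxy hx2.right_mem hyZ))

/-- The inductive step of Menger's theorem: glueing two linkages along a separator. -/
theorem linked_insert_edge [DecidableEq V] {E : Set (Sym2 V)} {x y : V} {S : Finset V}
    (ih : ∀ A B : Set V, (∀ Z : Finset V, (fromEdgeSet E).Separates Z A B → k ≤ Z.card) →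
      (fromEdgeSet E).Linked k A B)
    (h : ∀ Z : Finset V, (fromEdgeSet (insert s(x, y) E)).Separates Z A B → k ≤ Z.card)
    (hS : (fromEdgeSet E).Separates S A B) (hSk : S.card < k)
    (hx : ∃ a ∈ A, (fromEdgeSet E).ReachableIn (S : Set V)ᶜ a x)
    (hy : ∃ b ∈ B, (fromEdgeSet E).ReachableIn (S : Set V)ᶜ y b) :
    (fromEdgeSet (insert s(x, y) E)).Linked k A B := by
  obtain ⟨a₀, ha₀, hax⟩ := hx
  obtain ⟨b₀, hb₀, hyb⟩ := hy
  have hxS : x ∉ S := hax.right_mem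
  have hyS : y ∉ S := hyb.left_mem
  have hxB : ∀ b ∈ B, ¬ (fromEdgeSet E).ReachableIn (S : Set V)ᶜ x b :=
    fun b hb hxb => hS a₀ ha₀ b hb (hax.trans hxb)
  have hAy : ∀ a ∈ A, ¬ (fromEdgeSet E).ReachableIn (S : Set V)ᶜ a y :=
    fun a ha hay => hS a ha b₀ hb₀ (hay.trans hyb)
  have hxy : x ≠ y := by
    rintro rfl
    exact hAy a₀ ha₀ hax
  have hSxB : (fromEdgeSet E).Separates S {x} B := by
    rintro _ rfl
    exact hxB
  have hSAy : (fromEdgeSet E).Separates S A {y} := by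
    rintro a ha _ rfl
    exact hAy a ha
  -- A set separating `A` from `S ∪ {x}` without the new edge separates `A` from `B` with it: a walk
  -- from `A` to `B` meets `S`, or reaches the edge at `x`, or reaches it at `y`, having met `S` on
  -- the way.
  have h1 : (fromEdgeSet E).Linked k A (insert x S : Finset V) := by
    refine ih _ _ fun Z hZ => h Z fun a ha b hb hab => ?_
    have hit : ∀ s ∈ S, ¬ (fromEdgeSet E).ReachableIn (Z : Set V)ᶜ a s :=
      fun s hs => hZ a ha s (by simp [hs])
    rcases hab.fromEdgeSet_insert with hab | ⟨hab, -⟩ | ⟨hab, -⟩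
    · obtain ⟨z, hz, hz', -⟩ := hS.exists_hit ha hb hab
      exact hit z hz hz'
    · exact hZ a ha x (by simp) hab
    · obtain ⟨z, hz, hz', -⟩ := hSAy.exists_hit ha rfl hab
      exact hit z hz hz'
  have h2 : (fromEdgeSet E).Linked k (insert y S : Finset V) B := by
    refine ih _ _ fun Z hZ => h Z fun a ha b hb hab => ?_
    have hit : ∀ s ∈ S, ¬ (fromEdgeSet E).ReachableIn (Z : Set V)ᶜ s b :=
      fun s hs => hZ s (by simp [hs]) b hb
    rcases hab.fromEdgeSet_insert with hab | ⟨-, hab⟩ | ⟨-, hab⟩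
    · obtain ⟨z, hz, -, hz'⟩ := hS.exists_hit ha hb hab
      exact hit z hz hz'
    · exact hZ y (by simp) b hb hab
    · obtain ⟨z, hz, -, hz'⟩ := hSxB.exists_hit rfl hb hab
      exact hit z hz hz'
  -- The linkage `h1` has `k` distinct ends in `S ∪ {x}`, so `S` has exactly `k - 1` elements.
  have hcard : ∀ z ∉ S, (insert z S).card = k := by
    intro z hz
    refine le_antisymm (by rw [Finset.card_insert_of_notMem hz]; exact hSk) ?_
    rw [Finset.card_insert_of_notMem hz, ← Finset.card_insert_of_notMem hxS]
    obtain ⟨T, a, b, U, hT, hU, hd⟩ := h1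
    rw [← hT]
    refine Finset.card_le_card_of_injOn b (fun t ht => (hU t ht).2.1) fun s hs t ht hst => ?_
    by_contra hne
    refine Set.disjoint_left.1 (hd hs ht hne) (hU s hs).2.2.right_mem ?_
    rw [hst]
    exact (hU t ht).2.2.right_mem
  obtain ⟨a, U, hU, hUd⟩ := h1.exists_onto (hcard x hxS)
  obtain ⟨b, U', hU', hUd'⟩ := h2.symm.exists_onto (hcard y hyS)
  have hsub : ∀ z : V, ((insert z S : Finset V) : Set V)ᶜ ⊆ (S : Set V)ᶜ := fun z =>
    Set.compl_subset_compl.2 (Finset.coe_subset.2 (Finset.subset_insert _ _))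
  have hle : fromEdgeSet E ≤ fromEdgeSet (insert s(x, y) E) :=
    fromEdgeSet_mono (Set.subset_insert _ _)
  -- Paths ending in `S` are glued at their common end; the path ending at `x` continues along the
  -- new edge to `y`.
  set φ : V → V := fun t => if t = x then y else t with hφ
  have hφx : φ x = y := if_pos rfl
  have hφS : ∀ t ∈ S, φ t = t := fun t ht => if_neg (by rintro rfl; exact hxS ht)
  have hφmem : ∀ t ∈ insert x S, φ t ∈ insert y S := by
    intro t ht
    rcases Finset.mem_insert.1 ht with rfl | ht
    · simp [hφx]
    · simp [hφS t ht, ht]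
  -- A crossing of paths with different ends would give a walk off `S` from `A` to `B`, from `A` to
  -- `y` or from `x` to `B`, or would identify ends that are distinct.
  have hmeet : ∀ s ∈ insert x S, ∀ t ∈ insert x S, s ≠ t → Disjoint (U s) (U' (φ t)) := by
    intro s hs t ht hst
    refine Set.disjoint_left.2 fun z hz hz' => ?_
    have hsA := (hU s hs).1
    have htB := (hU' _ (hφmem t ht)).1
    rcases (hU s hs).2.2.2 z hz with rfl | hzA <;>
      rcases (hU' _ (hφmem t ht)).2.2.2 z hz' with hzt | hzB
    · rcases Finset.mem_insert.1 ht with rfl | ht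
      · rw [hφx] at hzt
        subst hzt
        rcases Finset.mem_insert.1 hs with h | h
        · exact hxy h.symm
        · exact hyS h
      · exact hst (hzt.trans (hφS t ht))
    · rcases Finset.mem_insert.1 hs with rfl | hs
      · exact hxB _ htB (hzB.symm.mono (hsub y))
      · exact (hsub y hzB.right_mem) hs
    · subst hzt
      rcases Finset.mem_insert.1 ht with rfl | ht
      · rw [hφx] at hzA
        exact hAy _ hsA (hzA.mono (hsub t))
      · rw [hφS t ht] at hzA
        exact (hsub x hzA.right_mem) ht
    · exact hS _ hsA _ htB ((hzA.mono (hsub x)).trans (hzB.symm.mono (hsub y)))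
  refine ⟨insert x S, a, fun t => b (φ t), fun t => U t ∪ U' (φ t), hcard x hxS,
    fun t ht => ⟨(hU t ht).1, (hU' _ (hφmem t ht)).1, ?_⟩, ?_⟩
  · have ht1 : (fromEdgeSet (insert s(x, y) E)).ReachableIn (U t ∪ U' (φ t)) (a t) t :=
      ((hU t ht).2.2.1.mono_graph hle).mono Set.subset_union_left
    have ht2 : (fromEdgeSet (insert s(x, y) E)).ReachableIn (U t ∪ U' (φ t)) (φ t) (b (φ t)) :=
      ((hU' _ (hφmem t ht)).2.2.1.symm.mono_graph hle).mono Set.subset_union_right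
    refine ht1.trans (.trans ?_ ht2)
    rcases Finset.mem_insert.1 ht with rfl | htS
    · refine .of_adj ?_ ht1.right_mem ht2.left_mem
      rw [hφx, fromEdgeSet_adj]
      exact ⟨Or.inl rfl, hxy⟩
    · rw [hφS t htS] at ht2 ⊢
      exact .refl ht2.left_mem
  · intro s hs t ht hst
    have hφst : φ s ≠ φ t := by
      rcases Finset.mem_insert.1 hs with hs' | hs' <;>
        rcases Finset.mem_insert.1 ht with ht' | ht'
      · exact absurd (hs'.trans ht'.symm) hst
      · rw [hs', hφx, hφS t ht']
        rintro rfl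
        exact hyS ht'
      · rw [ht', hφx, hφS s hs']
        rintro rfl
        exact hyS hs'
      · rwa [hφS s hs', hφS t ht']
    rw [Function.onFun, Set.disjoint_union_left, Set.disjoint_union_right,
      Set.disjoint_union_right]
    exact ⟨⟨hUd hs ht hst, hmeet s hs t ht hst⟩, (hmeet t ht s hs hst.symm).symm,
      hUd' (hφmem s hs) (hφmem t ht) hφst⟩

/-- **Menger's theorem** for graphs with finitely many edges. -/
theorem linked_of_separates_fromEdgeSet (E : Finset (Sym2 V)) :
    ∀ A B : Set V, (∀ Z : Finset V, (fromEdgeSet (E : Set (Sym2 V))).Separates Z A B →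
      k ≤ Z.card) → (fromEdgeSet (E : Set (Sym2 V))).Linked k A B := by
  classical
  induction E using Finset.induction_on with
  | empty =>
    intro A B h
    have hAB : ∃ T : Finset V, (T : Set V) ⊆ A ∩ B ∧ T.card = k := by
      by_cases hfin : (A ∩ B).Finite
      · have : k ≤ hfin.toFinset.card := by
          refine h _ fun a ha b hb hab => ?_
          obtain ⟨p, hp⟩ := hab
          cases p with
          | nil => exact hp a (by simp) (by simpa using And.intro ha hb)
          | cons h _ => simp at h
        obtain ⟨T, hT, hTk⟩ := Finset.exists_subset_card_eq this
        exact ⟨T, fun t ht => by simpa using hT ht, hTk⟩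
      · exact Set.Infinite.exists_subset_card_eq hfin k
    obtain ⟨T, hT, hTk⟩ := hAB
    exact ⟨T, id, id, fun t => {t}, hTk, fun t ht => ⟨(hT ht).1, (hT ht).2, .refl rfl⟩,
      fun s _ t _ hst => Set.disjoint_singleton.2 hst⟩
  | insert e E _ ih =>
    intro A B h
    induction e using Sym2.ind with
    | _ x y =>
    rw [Finset.coe_insert] at h ⊢
    by_cases hsep : ∀ Z : Finset V, (fromEdgeSet (E : Set (Sym2 V))).Separates Z A B → k ≤ Z.card
    · exact (ih A B hsep).mono_graph (fromEdgeSet_mono (Set.subset_insert _ _))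
    push Not at hsep
    obtain ⟨S, hS, hSk⟩ := hsep
    have hns : ¬ (fromEdgeSet (insert s(x, y) (E : Set (Sym2 V)))).Separates S A B :=
      fun hns => absurd (h S hns) (not_le.2 hSk)
    unfold Separates at hns
    push Not at hns
    obtain ⟨a, ha, b, hb, hab⟩ := hns
    rcases hab.fromEdgeSet_insert with hab | ⟨hax, hyb⟩ | ⟨hay, hxb⟩
    · exact absurd hab (hS a ha b hb)
    · exact linked_insert_edge ih h hS hSk ⟨a, ha, hax⟩ ⟨b, hb, hyb⟩
    · rw [Sym2.eq_swap] at h ⊢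
      exact linked_insert_edge ih h hS hSk ⟨a, ha, hay⟩ ⟨b, hb, hxb⟩

/-- **Menger's theorem** for arbitrary graphs and finite `k`. -/
theorem linked_of_separates (H : SimpleGraph V) (A B : Set V)
    (h : ∀ Z : Finset V, H.Separates Z A B → k ≤ Z.card) : H.Linked k A B := by
  classical
  by_contra hcon
  have hsub : ∀ E : Finset (Sym2 V), fromEdgeSet ((E.filter (· ∈ H.edgeSet) : Finset (Sym2 V)) :
      Set (Sym2 V)) ≤ H := by
    intro E u v huv
    simp only [fromEdgeSet_adj, Finset.coe_filter, Set.mem_ofPred_eq, mem_edgeSet] at huv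
    exact huv.1.2
  have hZ : ∀ E : Finset (Sym2 V), ∃ Z : Finset V,
      (fromEdgeSet ((E.filter (· ∈ H.edgeSet) : Finset (Sym2 V)) : Set (Sym2 V))).Separates Z A B ∧
        Z.card < k := by
    intro E
    by_contra! hE
    exact hcon ((linked_of_separates_fromEdgeSet _ A B hE).mono_graph (hsub E))
  choose Z hZsep hZk using hZ
  -- Compactness: the vertices lying in `Z E` for `𝒰`-almost all `E` number fewer than `k`. They
  -- separate, because a walk has finitely many vertices and its edges lie in almost all `E`.
  let 𝒰 : Ultrafilter (Finset (Sym2 V)) := Ultrafilter.of Filter.atTop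
  have h𝒰 : (𝒰 : Filter (Finset (Sym2 V))) ≤ Filter.atTop := Ultrafilter.of_le _
  have hcard : ∀ s : Finset V, (∀ v ∈ s, ∀ᶠ E in 𝒰, v ∈ Z E) → s.card < k := by
    intro s hs
    obtain ⟨E, hE⟩ := ((Filter.eventually_all_finset s).2 hs).exists
    exact (Finset.card_le_card fun v hv => hE v hv).trans_lt (hZk E)
  have hfin : {v | ∀ᶠ E in 𝒰, v ∈ Z E}.Finite := by
    by_contra hinf
    obtain ⟨s, hs, hsk⟩ := Set.Infinite.exists_subset_card_eq hinf k
    exact absurd (hcard s hs) (by omega)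
  refine absurd (hcard hfin.toFinset fun v hv => by simpa using hv)
    (not_lt.2 (h _ fun a ha b hb => ?_))
  rintro ⟨p, hp⟩
  have hev : ∀ᶠ E in 𝒰, ∃ z ∈ p.support.toFinset, z ∈ Z E := by
    filter_upwards [h𝒰 (Filter.eventually_ge_atTop p.edges.toFinset)] with E hE
    by_contra! hcon'
    have hedge : ∀ e ∈ p.edges,
        e ∈ (fromEdgeSet ((E.filter (· ∈ H.edgeSet) : Finset (Sym2 V)) : Set (Sym2 V))).edgeSet := by
      intro e he
      have heH := p.edges_subset_edgeSet he
      rw [edgeSet_fromEdgeSet]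
      refine ⟨?_, H.not_isDiag_of_mem_edgeSet heH⟩
      simp only [Finset.coe_filter, Set.mem_ofPred_eq]
      exact ⟨hE (by simpa using he), heH⟩
    refine hZsep E a ha b hb ⟨p.transfer _ hedge, fun z hz => ?_⟩
    rw [Walk.support_transfer] at hz
    exact hcon' z (by simpa using hz)
  have : ∃ z ∈ p.support.toFinset, ∀ᶠ E in 𝒰, z ∈ Z E := by
    by_contra! hcon'
    have := (Filter.eventually_all_finset p.support.toFinset).2
      fun z hz => hcon' z hz
    obtain ⟨E, ⟨z, hz, hzE⟩, hE⟩ := (hev.and this).exists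
    exact hE z hz hzE
  obtain ⟨z, hz, hzZ⟩ := this
  exact hp z (by simpa using hz) (by simpa using hzZ)

end SimpleGraph

/-! ### Distance balls and Kőnig's lemma. -/

namespace SimpleGraph

universe u

variable {V : Type u} {H : SimpleGraph V}

theorem ReachableIn.within {W : Set V} {u v : V} (h : H.ReachableIn W u v) :
    H.ReachableIn {z | H.ReachableIn W u z} u v := by
  have hv := h.right_mem
  refine h.head_induction (P := fun u => H.ReachableIn {z | H.ReachableIn W u z} u v)
    (.refl (.refl hv)) ?_
  intro x y hx hxy hy ih
  have hstep := ReachableIn.of_adj hxy hx hy.left_mem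
  exact (ReachableIn.of_adj hxy (.refl hx) hstep).trans (ih.mono fun z hz => hstep.trans hz)

theorem Connected.reachableIn_univ (hH : H.Connected) (u v : V) : H.ReachableIn Set.univ u v :=
  let ⟨p⟩ := hH.preconnected u v
  ⟨p, fun _ _ => Set.mem_univ _⟩

/-- A vertex outside `T` reaches a neighbour of `T` without meeting `T`. -/
theorem Connected.exists_adj_of_notMem (hH : H.Connected) {T : Set V} (hT : T.Nonempty) {v : V}
    (hv : v ∉ T) : ∃ x, ∃ t ∈ T, H.Adj t x ∧ H.ReachableIn Tᶜ v x := by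
  obtain ⟨t, ht⟩ := hT
  obtain ⟨x, y, hvx, hxy, hy, -⟩ := (hH.reachableIn_univ v t).exists_exit (S := Tᶜ) hv
    (fun h => h ht)
  exact ⟨x, y, not_not.1 hy, hxy.symm, hvx.mono Set.inter_subset_right⟩

/-- The closed ball of radius `n` about `o`. -/
def cball (H : SimpleGraph V) (o : V) (n : ℕ) : Set V := {v | H.dist o v ≤ n}

theorem Connected.exists_adj_dist_add_one (hH : H.Connected) {o v : V} (hv : v ≠ o) :
    ∃ w, H.Adj w v ∧ H.dist o w + 1 = H.dist o v := by
  obtain ⟨p, hp⟩ := hH.exists_walk_length_eq_dist v o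
  cases p with
  | nil => exact absurd rfl hv
  | @cons _ w _ h q =>
    refine ⟨w, h.symm, ?_⟩
    rw [Walk.length_cons] at hp
    have h1 := H.dist_le q
    have h2 := hH.dist_triangle (u := v) (v := w) (w := o)
    have h3 : H.dist v w ≤ 1 := H.dist_le h.toWalk
    rw [H.dist_comm (u := o) (v := w), H.dist_comm (u := o) (v := v)]
    omega

theorem Connected.dist_le_dist_add_one (hH : H.Connected) (o : V) {v w : V} (h : H.Adj v w) :
    H.dist o w ≤ H.dist o v + 1 := by
  have := hH.dist_triangle (u := o) (v := v) (w := w)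
  have : H.dist v w ≤ 1 := H.dist_le h.toWalk
  omega

theorem finite_cball (hH : H.Connected) (hfin : ∀ v, (H.neighborSet v).Finite) (o : V) (n : ℕ) :
    (H.cball o n).Finite := by
  induction n with
  | zero =>
    refine (Set.finite_singleton o).subset fun v hv => ?_
    exact (hH.dist_eq_zero_iff.1 (Nat.le_zero.1 hv)).symm
  | succ n ih =>
    refine (ih.union (ih.biUnion fun v _ => hfin v)).subset fun v hv => ?_
    by_cases hvo : v = o
    · exact Or.inl (by simp [cball, hvo])
    obtain ⟨w, hw, hwv⟩ := hH.exists_adj_dist_add_one hvo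
    refine Or.inr (Set.mem_biUnion (x := w) ?_ hw)
    have : H.dist o v ≤ n + 1 := hv
    show H.dist o w ≤ n
    omega

/-- **Kőnig's lemma**: an infinite connected part of a locally finite graph contains a ray. -/
theorem exists_ray_of_infinite (hfin : ∀ v, (H.neighborSet v).Finite) {W : Set V} {r : V}
    (hr : {w | H.ReachableIn W r w}.Infinite) : ∃ R : Ray H, R.verts ⊆ W := by
  classical
  -- A state consists of the vertices already used and the current vertex, from which infinitely
  -- many vertices remain reachable.
  let P : Set V × V → Prop := fun q => {w | H.ReachableIn (W \ q.1) q.2 w}.Infinite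
  have hstep : ∀ q : {q // P q}, ∃ q' : {q // P q}, H.Adj q.1.2 q'.1.2 ∧
      q'.1.1 = insert q.1.2 q.1.1 := by
    rintro ⟨⟨X, v⟩, hP⟩
    have hsub : {w | H.ReachableIn (W \ X) v w} ⊆
        {v} ∪ ⋃ x ∈ H.neighborSet v, {w | H.ReachableIn (W \ insert v X) x w} := by
      intro w hw
      by_cases hwv : w = v
      · exact Or.inl hwv
      obtain ⟨x, y, hwx, hxy, hy, -⟩ := (ReachableIn.symm hw).exists_exit (S := {v}ᶜ) hwv (by simp)
      obtain rfl : y = v := by simpa using hy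
      refine Or.inr (Set.mem_biUnion (x := x) hxy.symm ?_)
      refine hwx.symm.mono fun z hz => ⟨hz.1.1, ?_⟩
      rintro (h | h)
      · exact hz.2 h
      · exact hz.1.2 h
    by_contra! hcon
    refine hP (((Set.finite_singleton v).union ((hfin v).biUnion fun x hx => ?_)).subset hsub)
    by_contra hinf
    exact hcon ⟨(insert v X, x), hinf⟩ hx rfl
  choose next hadj hnext using hstep
  let q : ℕ → {q // P q} := fun n => next^[n] ⟨(∅, r), by simpa [P] using hr⟩
  have hq : ∀ n, q (n + 1) = next (q n) := fun n => Function.iterate_succ_apply' next n _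
  have hmem : ∀ n, (q n).1.2 ∈ W \ (q n).1.1 := fun n => (q n).2.nonempty.some_mem.left_mem
  have hX : ∀ m n, m < n → (q m).1.2 ∈ (q n).1.1 := by
    intro m n hmn
    induction n, hmn using Nat.le_induction with
    | base => rw [hq, hnext]; exact Or.inl rfl
    | succ n _ ih => rw [hq, hnext]; exact Or.inr ih
  refine ⟨⟨fun n => (q n).1.2, fun m n hmn => ?_, fun n => ?_⟩, ?_⟩
  · by_contra hne
    dsimp only at hmn
    rcases lt_or_gt_of_ne hne with h | h
    · exact (hmem n).2 (hmn ▸ hX m n h)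
    · exact (hmem m).2 (hmn ▸ hX n m h)
  · rw [hq]
    exact hadj _
  · rintro _ ⟨n, rfl⟩
    exact (hmem n).1

/-! ### Thick ends from ultrafilters. -/

section Tail

variable (H) in
/-- The component of the complement of `T` that belongs to the ultrafilter `𝒲`. -/
def tail (𝒲 : Ultrafilter V) (T : Set V) : Set V := {v | {w | H.ReachableIn Tᶜ v w} ∈ 𝒲}

variable {𝒲 : Ultrafilter V} {T T' : Set V} {v w : V}

theorem notMem_of_mem_tail (hv : v ∈ H.tail 𝒲 T) : v ∉ T :=
  (𝒲.nonempty_of_mem hv).some_mem.left_mem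

theorem mem_tail_of_reachableIn (hv : v ∈ H.tail 𝒲 T) (h : H.ReachableIn Tᶜ v w) :
    w ∈ H.tail 𝒲 T :=
  Filter.mem_of_superset hv fun _ hz => h.symm.trans hz

theorem mem_tail_of_adj (hv : v ∈ H.tail 𝒲 T) (h : H.Adj v w) (hw : w ∉ T) :
    w ∈ H.tail 𝒲 T :=
  mem_tail_of_reachableIn hv (.of_adj h (notMem_of_mem_tail hv) hw)

theorem reachableIn_tail (hv : v ∈ H.tail 𝒲 T) (hw : w ∈ H.tail 𝒲 T) :
    H.ReachableIn (H.tail 𝒲 T) v w := by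
  obtain ⟨z, hz, hz'⟩ := 𝒲.nonempty_of_mem (Filter.inter_mem hv hw)
  exact ((hz.trans hz'.symm).within).mono fun x hx => mem_tail_of_reachableIn hv hx

/-- The smaller tail is connected and avoids `T`, so it lies in one component of the complement of
`T`. -/
theorem tail_subset_tail (h : Disjoint (H.tail 𝒲 T') T) : H.tail 𝒲 T' ⊆ H.tail 𝒲 T := by
  intro v hv
  refine Filter.mem_of_superset hv fun z hz => ?_
  exact (reachableIn_tail hv (mem_tail_of_reachableIn hv hz)).mono
    fun x hx => Set.disjoint_left.1 h hx

/-- If `T` is nonempty, every component of its complement contains a neighbour of `T`. So there are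
finitely many of them, and one belongs to the ultrafilter because `T` does not. -/
theorem tail_mem (hH : H.Connected) (hfin : ∀ v, (H.neighborSet v).Finite)
    (h𝒲 : ∀ s ∈ 𝒲, s.Infinite) (hT : T.Finite) : H.tail 𝒲 T ∈ 𝒲 := by
  suffices ∃ v, v ∈ H.tail 𝒲 T by
    obtain ⟨v, hv⟩ := this
    exact Filter.mem_of_superset hv fun z hz => mem_tail_of_reachableIn hv hz
  rcases T.eq_empty_or_nonempty with rfl | hne
  · obtain ⟨v⟩ := hH.nonempty
    refine ⟨v, Filter.mem_of_superset Filter.univ_mem fun w _ => ?_⟩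
    simpa using hH.reachableIn_univ v w
  have huniv : T ∪ ⋃ x ∈ ⋃ t ∈ T, H.neighborSet t, {w | H.ReachableIn Tᶜ x w} = Set.univ := by
    refine Set.eq_univ_of_forall fun v => ?_
    by_cases hv : v ∈ T
    · exact Or.inl hv
    obtain ⟨x, t, ht, htx, hvx⟩ := hH.exists_adj_of_notMem hne hv
    exact Or.inr (Set.mem_biUnion (Set.mem_biUnion ht htx) hvx.symm)
  have hmem : (T ∪ ⋃ x ∈ ⋃ t ∈ T, H.neighborSet t, {w | H.ReachableIn Tᶜ x w}) ∈ 𝒲 := by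
    rw [huniv]
    exact Filter.univ_mem
  rw [Ultrafilter.union_mem_iff,
    Ultrafilter.finite_biUnion_mem_iff (hT.biUnion fun t _ => hfin t)] at hmem
  rcases hmem with h | ⟨x, -, hx⟩
  · exact absurd hT (h𝒲 _ h)
  · exact ⟨x, hx⟩

/-- The pieces of the rays of a thick end between two consecutive minimal separators. -/
theorem exists_linkage_of_minimal (hH : H.Connected) (hfin : ∀ v, (H.neighborSet v).Finite)
    (h𝒲 : ∀ s ∈ 𝒲, s.Infinite) {B T B' T' : Finset V} (hBT : Disjoint (H.tail 𝒲 T) B)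
    (hmin : ∀ Z : Finset V, Disjoint (H.tail 𝒲 Z) B → T.card ≤ Z.card)
    (hBT' : Disjoint (H.tail 𝒲 T') B') (hTB' : T ⊆ B') (hT' : (T' : Set V) ⊆ H.tail 𝒲 T) :
    ∃ (σ : V → V) (U : V → Set V), (∀ t ∈ T, σ t ∈ T' ∧ (U t).Finite ∧
      H.ReachableIn (U t) t (σ t) ∧ U t ⊆ T ∪ H.tail 𝒲 T ∧ (∀ z ∈ U t, z ∈ T → z = t) ∧
      ∀ z ∈ U t, z ∈ (T' : Set V) ∪ H.tail 𝒲 T' → z = σ t) ∧ (T : Set V).PairwiseDisjoint U := by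
  have hdT : Disjoint (H.tail 𝒲 T') T := hBT'.mono_right hTB'
  have htt : H.tail 𝒲 T' ⊆ H.tail 𝒲 T := tail_subset_tail hdT
  -- By minimality of `T` it suffices that a set `Z` separating `T` from `T'` cuts its own tail off
  -- from `B`. Otherwise a walk off `Z` from `tail T'` to `B` leaves `tail T` through `T`, and
  -- before that leaves `tail T'` through `T'`.
  have hlink : H.Linked T.card T T' := by
    refine linked_of_separates H _ _ fun Z hZ => hmin Z (Set.disjoint_left.2 fun b hbZ hbB => ?_)
    obtain ⟨w, hwZ, hwT'⟩ := 𝒲.nonempty_of_mem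
      (Filter.inter_mem (tail_mem hH hfin h𝒲 Z.finite_toSet) (tail_mem hH hfin h𝒲 T'.finite_toSet))
    have hbw := (reachableIn_tail hbZ hwZ).mono fun z hz => notMem_of_mem_tail hz
    obtain ⟨x, y, hwx, hxy, hy, hyb⟩ := hbw.symm.exists_exit (S := H.tail 𝒲 T) (htt hwT')
      fun h => Set.disjoint_left.1 hBT h hbB
    have hyT : y ∈ T := by
      by_contra hyT
      exact hy (mem_tail_of_adj hwx.right_mem.2 hxy hyT)
    have hwy : H.ReachableIn (Z : Set V)ᶜ w y :=
      (hwx.mono Set.inter_subset_left).trans (.of_adj hxy hwx.right_mem.1 hyb.left_mem)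
    obtain ⟨x', y', hwx', hxy', hy', hyy'⟩ := hwy.exists_exit (S := H.tail 𝒲 T') hwT'
      fun h => Set.disjoint_left.1 hdT h hyT
    have hyT' : y' ∈ T' := by
      by_contra hyT'
      exact hy' (mem_tail_of_adj hwx'.right_mem.2 hxy' hyT')
    exact hZ y hyT y' hyT' hyy'.symm
  -- The paths are first cut so that they meet `T` only in `t`, then at their first vertex in `T'`;
  -- this confines them between the two separators.
  obtain ⟨b, U, hU, hUd⟩ := hlink.symm.exists_onto rfl
  have := fun t (ht : t ∈ T) =>
    (hU t ht).2.2.1.symm.exists_first_hit (B := (T' : Set V)) (hU t ht).1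
  choose! σ hσ U' hUU' hfinU hreach hfirst using this
  refine ⟨σ, U', fun t ht => ⟨hσ t ht, hfinU t ht, hreach t ht, fun z hz => ?_, fun z hz hzT => ?_,
    fun z hz hzT => ?_⟩, fun s hs t ht hst => (hUd hs ht hst).mono (hUU' s hs) (hUU' t ht)⟩
  · rcases (hU t ht).2.2.2 z (hUU' t ht hz) with rfl | h
    · exact Or.inl ht
    · exact Or.inr (mem_tail_of_reachableIn (hT' (hU t ht).1) h)
  · by_contra hne
    exact Set.disjoint_left.1 (hUd hzT ht hne) (hU z hzT).2.2.1.right_mem (hUU' t ht hz)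
  · rcases hfirst t ht z hz with h | h
    · exact h
    rcases hzT with hzT | hzT
    · exact absurd hzT h.right_mem
    · exact absurd ht (Set.disjoint_left.1 hdT (mem_tail_of_reachableIn hzT h.symm))

/-- By minimality each `t ∈ T'` has a neighbour in `tail T'`, hence in `tail T`. Since `tail T'`
avoids `B'`, which contains all neighbours of `T`, this `t` is not in `T`. -/
theorem subset_tail_of_minimal (hH : H.Connected) (hfin : ∀ v, (H.neighborSet v).Finite)
    (h𝒲 : ∀ s ∈ 𝒲, s.Infinite) {T B' T' : Finset V} (hBT' : Disjoint (H.tail 𝒲 T') B')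
    (hmin' : ∀ Z : Finset V, Disjoint (H.tail 𝒲 Z) B' → T'.card ≤ Z.card) (hTB' : T ⊆ B')
    (hNB' : ∀ t ∈ T, ∀ u, H.Adj t u → u ∈ B') : (T' : Set V) ⊆ H.tail 𝒲 T := by
  classical
  intro t ht
  have htt : H.tail 𝒲 T' ⊆ H.tail 𝒲 T := tail_subset_tail (hBT'.mono_right hTB')
  have hlt : (T'.erase t).card < T'.card := Finset.card_erase_lt_of_mem ht
  have hnd : ¬ Disjoint (H.tail 𝒲 (T'.erase t : Finset V)) B' :=
    fun h => absurd (hmin' _ h) (not_le.2 hlt)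
  obtain ⟨b, hb, hbB⟩ := Set.not_disjoint_iff.1 hnd
  have hsub : H.tail 𝒲 T' ⊆ H.tail 𝒲 (T'.erase t : Finset V) :=
    tail_subset_tail (Set.disjoint_left.2 fun z hz hz' =>
      notMem_of_mem_tail hz (Finset.mem_of_mem_erase hz'))
  obtain ⟨w, hw⟩ := 𝒲.nonempty_of_mem (tail_mem hH hfin h𝒲 T'.finite_toSet)
  obtain ⟨x, y, hwx, hxy, hy, hyb⟩ := (reachableIn_tail (hsub hw) hb).exists_exit hw
    fun h => Set.disjoint_left.1 hBT' h hbB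
  have hx : x ∈ H.tail 𝒲 T' := hwx.right_mem.2
  have hyt : y = t := by
    by_contra hne
    refine hy (mem_tail_of_adj hx hxy fun hyT => ?_)
    exact notMem_of_mem_tail hyb.left_mem (Finset.mem_erase.2 ⟨hne, hyT⟩)
  subst hyt
  refine mem_tail_of_adj (htt hx) hxy fun hyT => ?_
  exact Set.disjoint_left.1 hBT' hx (hNB' y hyT x hxy.symm)

theorem exists_minimal_separators (hH : H.Connected) (hfin : ∀ v, (H.neighborSet v).Finite) (o : V)
    (hthick : ∀ m : ℕ, ∃ B : Finset V, ∀ T : Finset V, Disjoint (H.tail 𝒲 T) B → m < T.card) :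
    ∃ B T : ℕ → Finset V, ∀ n, Disjoint (H.tail 𝒲 (T n)) (B n) ∧
      (∀ Z : Finset V, Disjoint (H.tail 𝒲 Z) (B n) → (T n).card ≤ Z.card) ∧
      T n ⊆ B (n + 1) ∧ (∀ t ∈ T n, ∀ u, H.Adj t u → u ∈ B (n + 1)) ∧
      H.cball o n ⊆ B (n + 1) ∧ (T n).card < (T (n + 1)).card := by
  classical
  have hsep : ∀ B : Finset V, ∃ T : Finset V, Disjoint (H.tail 𝒲 T) B ∧
      ∀ Z : Finset V, Disjoint (H.tail 𝒲 Z) B → T.card ≤ Z.card := by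
    intro B
    obtain ⟨T, hT, hmin⟩ := (measure (Finset.card (α := V))).wf.has_min
      {T : Finset V | Disjoint (H.tail 𝒲 T) B}
      ⟨B, Set.disjoint_left.2 fun z hz => notMem_of_mem_tail hz⟩
    exact ⟨T, hT, fun Z hZ => not_lt.1 (hmin Z hZ)⟩
  choose sep hsep hmin using hsep
  choose big hbig using hthick
  -- The separator and its neighbours push the next separator into the tail, the ball makes the
  -- tails leave every finite set, and `big` forces the separators to grow.
  let next : ℕ → Finset V → Finset V := fun n B =>
    sep B ∪ (sep B).biUnion (fun t => (hfin t).toFinset) ∪ (finite_cball hH hfin o n).toFinset ∪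
      big (sep B).card
  let B : ℕ → Finset V := fun n => Nat.rec (motive := fun _ => Finset V) ∅ next n
  have hB : ∀ n, B (n + 1) = next n (B n) := fun n => rfl
  refine ⟨B, fun n => sep (B n), fun n => ⟨hsep _, hmin _, ?_, ?_, ?_, ?_⟩⟩
  · rw [hB]
    intro t ht
    simp [next, ht]
  · rw [hB]
    intro t ht u htu
    simp only [next, Finset.mem_union, Finset.mem_biUnion, Set.Finite.mem_toFinset]
    exact Or.inl (Or.inl (Or.inr ⟨t, ht, htu⟩))
  · rw [hB]
    intro t ht
    simp only [next, Finset.coe_union, Set.Finite.coe_toFinset]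
    exact Or.inl (Or.inr ht)
  · refine hbig _ _ ((hsep _).mono_right ?_)
    rw [hB]
    intro t ht
    simp only [next, Finset.coe_union]
    exact Or.inr ht

/-- A direction that cannot be cut off from large finite sets by few vertices defines a thick
end. -/
theorem hasThickEnd_of_ultrafilter (hH : H.Connected) (hfin : ∀ v, (H.neighborSet v).Finite)
    (h𝒲 : ∀ s ∈ 𝒲, s.Infinite)
    (hthick : ∀ m : ℕ, ∃ B : Finset V, ∀ T : Finset V, Disjoint (H.tail 𝒲 T) B → m < T.card) :
    H.HasThickEnd := by
  classical
  obtain ⟨o⟩ := hH.nonempty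
  obtain ⟨B, T, hBT⟩ := exists_minimal_separators hH hfin o hthick
  choose hdis hmin hTB hNB hball hcard using hBT
  set D : ℕ → Set V := fun n => H.tail 𝒲 (T n) with hD
  have hTD : ∀ n, (T (n + 1) : Set V) ⊆ D n := fun n =>
    subset_tail_of_minimal hH hfin h𝒲 (hdis (n + 1)) (hmin (n + 1)) (hTB n) (hNB n)
  have hDD : ∀ n, D (n + 1) ⊆ D n := fun n =>
    tail_subset_tail ((hdis (n + 1)).mono_right (hTB n))
  have hanti : Antitone D := antitone_nat_of_succ_le hDD
  have hTD' : ∀ a b, a < b → (T b : Set V) ∪ D b ⊆ D a := by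
    intro a b hab
    obtain ⟨c, rfl⟩ : ∃ c, b = c + 1 := ⟨b - 1, by omega⟩
    exact (Set.union_subset (hTD c) (hDD c)).trans (hanti (by omega))
  have hTnD : ∀ n, ∀ t ∈ T n, t ∉ D n := fun n t ht h => notMem_of_mem_tail h ht
  have hlink := fun n => exists_linkage_of_minimal hH hfin h𝒲 (hdis n) (hmin n) (hdis (n + 1))
    (hTB n) (hTD n)
  choose σ U hU hUd using hlink
  have hσT : ∀ n, ∀ t ∈ T n, σ n t ∈ T (n + 1) := fun n t ht => (hU n t ht).1
  have hUsub : ∀ n, ∀ t ∈ T n, U n t ⊆ (T n : Set V) ∪ D n := fun n t ht => (hU n t ht).2.2.2.1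
  have hσinj : ∀ n, Set.InjOn (σ n) (T n) := by
    intro n s hs t ht hst
    by_contra hne
    refine Set.disjoint_left.1 (hUd n hs ht hne) (hU n s hs).2.2.1.right_mem ?_
    rw [hst]
    exact (hU n t ht).2.2.1.right_mem
  -- As the separators grow, each level offers a vertex at which no earlier path ends; a new chain
  -- `c n` starts there, at level `n + 1`.
  have hstart : ∀ n, ∃ s ∈ T (n + 1), s ∉ (T n).image (σ n) := fun n =>
    Finset.exists_mem_notMem_of_card_lt_card (Finset.card_image_le.trans_lt (hcard n))
  choose s hsT hsσ using hstart
  let c : ℕ → ℕ → V := fun n i => Nat.rec (motive := fun _ => V) (s n) (fun i x => σ (n + 1 + i) x) i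
  have hc0 : ∀ n, c n 0 = s n := fun n => rfl
  have hcs : ∀ n i, c n (i + 1) = σ (n + 1 + i) (c n i) := fun n i => rfl
  have hcT : ∀ n i, c n i ∈ T (n + 1 + i) := by
    intro n i
    induction i with
    | zero => exact hsT n
    | succ i ih => exact hσT _ _ ih
  -- Pieces of different levels meet only if one is the immediate continuation of the other.
  have hmeet : ∀ a b, a < b → ∀ t ∈ T a, ∀ t' ∈ T b, ∀ v ∈ U a t, v ∈ U b t' →
      b = a + 1 ∧ t' = σ a t := by
    intro a b hab t ht t' ht' v hv hv'
    have hvb := hUsub b t' ht' hv'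
    have hva : v ∈ (T (a + 1) : Set V) ∪ D (a + 1) := by
      rcases (show b = a + 1 ∨ a + 1 < b by omega) with rfl | h
      · exact hvb
      · exact Or.inr (hTD' _ _ h hvb)
    have hvσ := (hU a t ht).2.2.2.2.2 v hv hva
    have hb : b = a + 1 := by
      by_contra hne
      refine hTnD (a + 1) _ (hσT a t ht) ?_
      rw [← hvσ]
      exact hTD' _ _ (by omega) hvb
    subst hb
    refine ⟨rfl, ?_⟩
    rw [← (hU _ t' ht').2.2.2.2.1 v hv' (hvσ ▸ hσT a t ht), hvσ]
  have hcne : ∀ n m, n < m → ∀ j i, n + 1 + i = m + 1 + j → c n i ≠ c m j := by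
    intro n m hnm j
    induction j with
    | zero =>
      intro i hi h
      obtain ⟨k, rfl⟩ : ∃ k, i = k + 1 := ⟨i - 1, by omega⟩
      have hk : n + 1 + k = m := by omega
      refine hsσ m (Finset.mem_image.2 ⟨c n k, hk ▸ hcT n k, ?_⟩)
      rw [← hc0 m, ← h, hcs, hk]
    | succ j ih =>
      intro i hi h
      obtain ⟨k, rfl⟩ : ∃ k, i = k + 1 := ⟨i - 1, by omega⟩
      have hk : n + 1 + k = m + 1 + j := by omega
      rw [hcs, hcs, hk] at h
      exact ih k hk (hσinj _ (hk ▸ hcT n k) (hcT m j) h)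
  set W : ℕ → Set V := fun n => ⋃ i, U (n + 1 + i) (c n i) with hW
  have hWd : ∀ n m, n < m → Disjoint (W n) (W m) := by
    intro n m hnm
    refine Set.disjoint_left.2 fun v hv hv' => ?_
    obtain ⟨i, hi⟩ := Set.mem_iUnion.1 hv
    obtain ⟨j, hj⟩ := Set.mem_iUnion.1 hv'
    rcases lt_trichotomy (n + 1 + i) (m + 1 + j) with h | h | h
    · obtain ⟨h1, h2⟩ := hmeet _ _ h _ (hcT n i) _ (hcT m j) v hi hj
      exact hcne n m hnm j (i + 1) (by omega) (by rw [hcs, h2])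
    · rw [h] at hi
      exact Set.disjoint_left.1 (hUd _ (h ▸ hcT n i) (hcT m j) (hcne n m hnm j i h)) hi hj
    · obtain ⟨h1, h2⟩ := hmeet _ _ h _ (hcT m j) _ (hcT n i) v hj hi
      exact hcne n m hnm (j + 1) i (by omega) (by rw [hcs, h2])
  have hcinj : ∀ n, Function.Injective (c n) := by
    intro n
    refine Function.Injective.of_lt_imp_ne fun i j hij h => hTnD _ _ (hcT n i) ?_
    rw [h]
    exact hTD' _ _ (by omega) (Or.inl (hcT n j))
  have hcreach : ∀ n i, H.ReachableIn (W n) (s n) (c n i) := by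
    intro n i
    have hUW : ∀ i, U (n + 1 + i) (c n i) ⊆ W n := fun i =>
      Set.subset_iUnion (fun i => U (n + 1 + i) (c n i)) i
    induction i with
    | zero => exact .refl (hUW 0 (hU _ _ (hcT n 0)).2.2.1.left_mem)
    | succ i ih => exact ih.trans ((hU _ _ (hcT n i)).2.2.1.mono (hUW i))
  have hray : ∀ n, ∃ R : Ray H, R.verts ⊆ W n := fun n =>
    exists_ray_of_infinite hfin (Set.infinite_of_injective_forall_mem (hcinj n) (hcreach n))
  choose R hR using hray
  -- Only finitely many pieces of `W n` are not contained in `D j`, and each piece is finite.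
  have hRD : ∀ n j, ∃ k, (R n).vert k ∈ D j := by
    intro n j
    have hsub : W n \ D j ⊆ ⋃ i ∈ Set.Iic j, U (n + 1 + i) (c n i) := by
      rintro v ⟨hv, hvD⟩
      obtain ⟨i, hi⟩ := Set.mem_iUnion.1 hv
      refine Set.mem_biUnion (x := i) ?_ hi
      by_contra hij
      exact hvD (hTD' j (n + 1 + i) (by simp at hij; omega) (hUsub _ _ (hcT n i) hi))
    have hWfin : (W n \ D j).Finite :=
      ((Set.finite_Iic j).biUnion fun i _ => (hU _ _ (hcT n i)).2.1).subset hsub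
    obtain ⟨k, hk⟩ := (hWfin.preimage (R n).injective.injOn).exists_notMem
    refine ⟨k, ?_⟩
    by_contra hkD
    exact hk ⟨hR n ⟨k, rfl⟩, hkD⟩
  have hequiv : ∀ n m, (R n).Equivalent (R m) := by
    intro n m
    rw [Ray.equivalent_iff]
    intro X hX
    obtain ⟨j, hj⟩ := (hX.image (H.dist o)).bddAbove
    -- The tail with index `j + 1` avoids `B (j + 1)`, which contains the ball of radius `j` and so
    -- all of `X`.
    obtain ⟨k, hk⟩ := hRD n (j + 1)
    obtain ⟨l, hl⟩ := hRD m (j + 1)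
    obtain ⟨p, hp⟩ := reachableIn_tail hk hl
    refine ⟨k, l, p, fun v hv hvX => ?_⟩
    exact Set.disjoint_left.1 (hdis (j + 1)) (hp v hv) (hball j (hj ⟨v, hvX, rfl⟩))
  have hRdis : ∀ n m, n ≠ m → Disjoint (R n).verts (R m).verts := by
    intro n m hnm
    rcases lt_or_gt_of_ne hnm with h | h
    · exact (hWd n m h).mono (hR n) (hR m)
    · exact ((hWd m n h).mono (hR m) (hR n)).symm
  have hRinj : Function.Injective R := by
    intro n m h
    by_contra hne
    have := hRdis n m hne
    rw [h] at this
    exact Set.disjoint_left.1 this ⟨0, rfl⟩ ⟨0, rfl⟩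
  refine ⟨(R 0).toEnd, Set.range R, Set.infinite_range_of_injective hRinj, ?_, ?_⟩
  · rintro _ ⟨n, rfl⟩
    exact Quotient.sound (hequiv n 0)
  · rintro _ ⟨n, rfl⟩ _ ⟨m, rfl⟩ h
    exact hRdis n m fun hnm => h (by rw [hnm])

end Tail

end SimpleGraph

/-! ### A tree-decomposition from the distance levels. -/

namespace SimpleGraph

universe u

variable {V : Type u} {H : SimpleGraph V}

/-- The graph of a parent function that decreases a level function down to a unique root is a
tree. -/
theorem isTree_fromRel_parent {Q : Type*} (parent : Q → Q) (level : Q → ℕ) (root : Q)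
    (hroot : ∀ q, level q = 0 → q = root) (hparent : parent root = root)
    (hlevel : ∀ q, level q ≠ 0 → level (parent q) + 1 = level q) :
    (fromRel fun a b => parent a = b).IsTree := by
  set F : SimpleGraph Q := fromRel fun a b => parent a = b with hF
  have hne : ∀ q, q ≠ parent q → level q ≠ 0 := by
    intro q hq h0
    rw [hroot q h0, hparent] at hq
    exact hq rfl
  have hle : ∀ q, level (parent q) ≤ level q := by
    intro q
    by_cases h : q = parent q
    · rw [← h]
    · have := hlevel q (hne q h)
      omega
  have hiter : ∀ n q, level (parent^[n] q) ≤ level q := by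
    intro n
    induction n with
    | zero => exact fun q => le_rfl
    | succ n ih => exact fun q => (ih (parent q)).trans (hle q)
  have hreach : ∀ n q, level q = n → F.Reachable q root := by
    intro n
    induction n with
    | zero =>
      intro q hq
      rw [hroot q hq]
    | succ n ih =>
      intro q hq
      have hq' := hlevel q (by omega)
      have hqp : q ≠ parent q := by
        intro h
        rw [← h] at hq'
        omega
      have hadj : F.Adj q (parent q) := (fromRel_adj _ _ _).2 ⟨hqp, Or.inl rfl⟩
      exact hadj.reachable.trans (ih _ (by omega))
  have hbridge : ∀ q, q ≠ parent q → ¬ (F.deleteEdges {s(q, parent q)}).Reachable q (parent q) := by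
    rintro q hq ⟨p⟩
    have hnot : ¬ ∃ n, parent^[n] (parent q) = q := by
      rintro ⟨n, hn⟩
      have h1 := hiter n (parent q)
      have h2 := hlevel q (hne q hq)
      rw [hn] at h1
      omega
    -- The only edge leaving the set of descendants of `q` is the one from `q` to its parent.
    obtain ⟨d, -, ⟨n, hn⟩, hd⟩ := p.exists_boundary_dart {x | ∃ n, parent^[n] x = q} ⟨0, rfl⟩ hnot
    have hadj := d.adj
    rw [deleteEdges_adj] at hadj
    obtain ⟨hadj, hdel⟩ := hadj
    rcases ((fromRel_adj _ _ _).1 hadj).2 with h | h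
    · cases n with
      | zero =>
        refine hdel ?_
        have hq' : d.fst = q := hn
        rw [← h, hq']
        rfl
      | succ n =>
        refine hd ⟨n, ?_⟩
        rw [← h]
        exact hn
    · refine hd ⟨n + 1, ?_⟩
      rw [Function.iterate_succ_apply, h]
      exact hn
  have hconn : F.Connected := by
    have : Nonempty Q := ⟨root⟩
    exact Connected.mk fun a b => (hreach _ a rfl).trans (hreach _ b rfl).symm
  refine ⟨hconn, isAcyclic_iff_forall_adj_isBridge.2 fun a b hab => ?_⟩
  rw [isBridge_iff]
  obtain ⟨hne, h | h⟩ := (fromRel_adj _ _ _).1 hab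
  · subst h
    exact hbridge a hne
  · subst h
    rw [Sym2.eq_swap]
    exact fun hr => hbridge b hne.symm hr.symm

theorem IsTree.support_subset_of_reachableIn {Q : Type*} {F : SimpleGraph Q} (hF : F.IsTree)
    {S : Set Q} {a b : Q} (h : F.ReachableIn S a b) (p : F.Walk a b) (hp : p.IsPath) :
    ∀ t ∈ p.support, t ∈ S := by
  classical
  obtain ⟨q, hq⟩ := h
  have := isAcyclic_iff_subsingleton_path.1 hF.isAcyclic a b
  have hpq : p = q.bypass :=
    congrArg Subtype.val (Subsingleton.elim (⟨p, hp⟩ : F.Path a b) ⟨q.bypass, q.bypass_isPath⟩)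
  intro t ht
  rw [hpq] at ht
  exact hq t (q.support_bypass_subset_support ht)

variable (H) in
/-- Two vertices at the same distance from `o` are equivalent if they are joined by a walk that
comes no closer to `o`. -/
def LevelRel (o v w : V) : Prop :=
  H.dist o v = H.dist o w ∧ H.ReachableIn {z | H.dist o v ≤ H.dist o z} v w

theorem LevelRel.refl (o v : V) : H.LevelRel o v v := ⟨rfl, .refl (le_refl (H.dist o v))⟩

variable (H) in
/-- The setoid of `LevelRel`. -/
def levelSetoid (o : V) : Setoid V where
  r := H.LevelRel o
  iseqv :=
    { refl := LevelRel.refl o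
      symm := fun h => ⟨h.1.symm, h.1 ▸ h.2.symm⟩
      trans := fun h h' => ⟨h.1.trans h'.1, h.2.trans (h.1 ▸ h'.2)⟩ }

/-- This makes the parent of a class independent of the chosen vertex and of its chosen predecessor.
-/
theorem LevelRel.of_adj_of_adj {o v w v' w' : V} (h : H.LevelRel o v w)
    (hv : H.Adj v' v) (hv' : H.dist o v' + 1 = H.dist o v) (hw : H.Adj w' w)
    (hw' : H.dist o w' + 1 = H.dist o w) : H.LevelRel o v' w' := by
  have h1 := h.1
  refine ⟨by omega, .trans (.of_adj hv (le_refl (H.dist o v')) ?_) (.trans (h.2.mono fun z hz => ?_)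
    (.of_adj hw.symm ?_ ?_))⟩
  · show H.dist o v' ≤ H.dist o v
    omega
  · have : H.dist o v ≤ H.dist o z := hz
    show H.dist o v' ≤ H.dist o z
    omega
  · show H.dist o v' ≤ H.dist o w
    omega
  · show H.dist o v' ≤ H.dist o w'
    omega

/-- If the classes of `LevelRel` have bounded size, then the graph has finite tree-width. -/
theorem hasFiniteTreeWidth_of_levelRel (hH : H.Connected) (o : V) (N : ℕ)
    (hN : ∀ v, {w | H.LevelRel o w v}.encard ≤ N) : H.HasFiniteTreeWidth := by
  classical
  have hpre : ∀ v, ∃ w, v ≠ o → H.Adj w v ∧ H.dist o w + 1 = H.dist o v := by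
    intro v
    by_cases hv : v = o
    · exact ⟨v, fun h => absurd hv h⟩
    · obtain ⟨w, hw⟩ := hH.exists_adj_dist_add_one hv
      exact ⟨w, fun _ => hw⟩
  choose pre hpre using hpre
  have hzero : ∀ v, H.dist o v = 0 → v = o := fun v hv => (hH.dist_eq_zero_iff.1 hv).symm
  let pre' : V → V := fun v => if v = o then o else pre v
  have hpre' : ∀ v, v ≠ o → H.Adj (pre' v) v ∧ H.dist o (pre' v) + 1 = H.dist o v := by
    intro v hv
    simp only [pre', if_neg hv]
    exact hpre v hv
  let Q := Quotient (H.levelSetoid o)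
  let mk : V → Q := Quotient.mk (H.levelSetoid o)
  have hmk : ∀ v w, mk v = mk w ↔ H.LevelRel o v w := fun v w => Quotient.eq
  let parent : Q → Q := Quotient.lift (fun v => mk (pre' v)) (by
    intro v w h
    replace h : H.LevelRel o v w := h
    by_cases hv : v = o
    · have hw : w = o := hzero w (by rw [← h.1, hv, dist_self])
      rw [hv, hw]
    · have hw : w ≠ o := by
        rintro rfl
        exact hv (hzero v (by rw [h.1, dist_self]))
      exact (hmk _ _).2 (h.of_adj_of_adj (hpre' v hv).1 (hpre' v hv).2 (hpre' w hw).1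
        (hpre' w hw).2))
  have hparent : ∀ v w, H.Adj v w → H.dist o v + 1 = H.dist o w → parent (mk w) = mk v := by
    intro v w hvw hd
    have hw : w ≠ o := by
      rintro rfl
      rw [dist_self] at hd
      omega
    have : H.LevelRel o w w := .refl o w
    exact (hmk _ _).2 (this.of_adj_of_adj (hpre' w hw).1 (hpre' w hw).2 hvw hd)
  let level : Q → ℕ := Quotient.lift (fun v => H.dist o v) fun v w h => h.1
  have htree : (fromRel fun a b => parent a = b).IsTree := by
    refine isTree_fromRel_parent parent level (mk o) ?_ ?_ ?_
    · rintro ⟨v⟩ hv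
      exact congrArg mk (hzero v hv)
    · show mk (pre' o) = mk o
      simp [pre']
    · rintro ⟨v⟩ hv
      have hvo : v ≠ o := by
        rintro rfl
        exact hv (dist_self ..)
      exact (hpre' v hvo).2
  refine ⟨2 * N, ⟨Q, fromRel fun a b => parent a = b, htree,
    fun t => {v | t = mk v} ∪ {v | parent t = mk v}, fun v => ⟨mk v, Or.inl rfl⟩, ?_, ?_⟩, ?_⟩
  · intro v w hvw
    have h1 := hH.dist_le_dist_add_one o hvw
    have h2 := hH.dist_le_dist_add_one o hvw.symm
    rcases (by omega : H.dist o v + 1 = H.dist o w ∨ H.dist o w + 1 = H.dist o v ∨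
      H.dist o v = H.dist o w) with h | h | h
    · exact ⟨mk w, Or.inr (hparent v w hvw h), Or.inl rfl⟩
    · exact ⟨mk v, Or.inl rfl, Or.inr (hparent w v hvw.symm h)⟩
    · exact ⟨mk v, Or.inl rfl, Or.inl ((hmk v w).2 ⟨h, .of_adj hvw (le_refl (H.dist o v)) h.le⟩)⟩
  · rintro t₁ t₂ t₃ p hp ht₂ v ⟨hv₁, hv₃⟩
    -- The nodes whose bags contain `v` are its class and the children of that class: a star, hence
    -- connected.
    set S : Set Q := {t | t = mk v ∨ parent t = mk v} with hS
    have hto : ∀ t ∈ S, (fromRel fun a b => parent a = b).ReachableIn S t (mk v) := by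
      intro t ht
      by_cases htv : t = mk v
      · rw [htv]
        exact .refl (Or.inl rfl)
      · exact .of_adj ((fromRel_adj _ _ _).2 ⟨htv, Or.inl (ht.resolve_left htv)⟩) ht (Or.inl rfl)
    exact htree.support_subset_of_reachableIn ((hto t₁ hv₁).trans (hto t₃ hv₃).symm) p hp t₂ ht₂
  · intro t
    have hclass : ∀ q : Q, {v | q = mk v}.encard ≤ N := by
      rintro ⟨v⟩
      refine (Set.encard_le_encard fun w hw => ?_).trans (hN v)
      exact (hmk w v).1 (Eq.symm hw)
    calc ({v | t = mk v} ∪ {v | parent t = mk v}).encard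
        ≤ {v | t = mk v}.encard + {v | parent t = mk v}.encard := Set.encard_union_le _ _
      _ ≤ (N : ℕ∞) + N := add_le_add (hclass _) (hclass _)
      _ ≤ ((2 * N : ℕ) : ℕ∞) + 1 := by
        rw [two_mul, Nat.cast_add]
        exact le_self_add

end SimpleGraph

/-! ### Tight cuts in vertex-transitive graphs. -/

namespace SimpleGraph

universe u

variable {V : Type u} {H : SimpleGraph V}

theorem ReachableIn.of_adj_imp {H' : SimpleGraph V} {W : Set V} {u v : V}
    (h : H.ReachableIn W u v) (hadj : ∀ a ∈ W, ∀ b ∈ W, H.Adj a b → H'.Adj a b) :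
    H'.ReachableIn W u v := by
  refine h.head_induction (P := fun u => H'.ReachableIn W u v) (.refl h.right_mem) ?_
  intro a b ha hab hb ih
  exact (ReachableIn.of_adj (hadj a ha b hb.left_mem hab) ha hb.left_mem).trans ih

theorem ReachableIn.map_iso (φ : H ≃g H) {W : Set V} {u v : V} (h : H.ReachableIn W u v) :
    H.ReachableIn (φ '' W) (φ u) (φ v) := by
  refine h.head_induction (P := fun u => H.ReachableIn (φ '' W) (φ u) (φ v))
    (.refl ⟨v, h.right_mem, rfl⟩) ?_
  intro a b ha hab hb ih
  exact (ReachableIn.of_adj (W := φ '' W) (φ.map_adj_iff.2 hab) ⟨a, ha, rfl⟩ ⟨b, hb.left_mem, rfl⟩).trans ih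

theorem Connected.dist_iso_le (hH : H.Connected) (φ : H ≃g H) (u v : V) :
    H.dist (φ u) (φ v) ≤ H.dist u v := by
  obtain ⟨p, hp⟩ := hH.exists_walk_length_eq_dist u v
  rw [← hp, ← p.length_map φ.toHom]
  exact H.dist_le _

theorem Connected.dist_iso (hH : H.Connected) (φ : H ≃g H) (u v : V) :
    H.dist (φ u) (φ v) = H.dist u v := by
  refine le_antisymm (hH.dist_iso_le φ u v) ?_
  simpa using hH.dist_iso_le φ.symm (φ u) (φ v)

theorem Connected.image_cball (hH : H.Connected) (φ : H ≃g H) (v : V) (n : ℕ) :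
    φ '' H.cball v n = H.cball (φ v) n := by
  ext w
  constructor
  · rintro ⟨w, hw, rfl⟩
    exact (hH.dist_iso φ v w).le.trans hw
  · intro hw
    refine ⟨φ.symm w, ?_, φ.apply_symm_apply w⟩
    show H.dist v (φ.symm w) ≤ n
    rw [← hH.dist_iso φ, φ.apply_symm_apply]
    exact hw

variable (H) in
/-- The edges that leave `A`, directed outwards. -/
def outEdges (A : Set V) : Set (V × V) := {p | H.Adj p.1 p.2 ∧ p.1 ∈ A ∧ p.2 ∉ A}

variable (H) in
/-- `A` is one side of a cut with at most `k` edges, both of whose sides are connected. -/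
structure IsTightCut (k : ℕ) (A : Set V) : Prop where
  reachableIn : ∀ u ∈ A, ∀ v ∈ A, H.ReachableIn A u v
  reachableIn_compl : ∀ u ∈ Aᶜ, ∀ v ∈ Aᶜ, H.ReachableIn Aᶜ u v
  encard_le : (H.outEdges A).encard ≤ k

namespace IsTightCut

variable {k : ℕ} {A : Set V}

theorem mono {l : ℕ} (h : H.IsTightCut k A) (hkl : k ≤ l) : H.IsTightCut l A :=
  ⟨h.1, h.2, h.3.trans (by exact_mod_cast hkl)⟩

theorem compl (h : H.IsTightCut k A) : H.IsTightCut k Aᶜ := by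
  refine ⟨h.2, by simpa using h.1, le_trans (le_trans (Set.encard_le_encard ?_)
    (Set.encard_image_le Prod.swap (H.outEdges A))) h.3⟩
  rintro ⟨a, b⟩ ⟨hab, ha, hb⟩
  exact ⟨(b, a), ⟨hab.symm, not_not.1 hb, ha⟩, rfl⟩

theorem image (φ : H ≃g H) (h : H.IsTightCut k A) : H.IsTightCut k (φ '' A) := by
  refine ⟨?_, ?_, le_trans (le_trans (Set.encard_le_encard ?_)
    (Set.encard_image_le (Prod.map φ φ) (H.outEdges A))) h.3⟩
  · rintro _ ⟨u, hu, rfl⟩ _ ⟨v, hv, rfl⟩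
    exact (h.1 u hu v hv).map_iso φ
  · rw [← Set.image_compl_eq φ.bijective]
    rintro _ ⟨u, hu, rfl⟩ _ ⟨v, hv, rfl⟩
    exact (h.2 u hu v hv).map_iso φ
  · rintro ⟨a, b⟩ ⟨hab, ⟨a, ha, rfl⟩, hb⟩
    refine ⟨(a, φ.symm b), ⟨?_, ha, fun hb' => hb ⟨_, hb', φ.apply_symm_apply b⟩⟩, ?_⟩
    · rw [← φ.map_adj_iff]
      simpa using hab
    · simp

/-- Walks inside either side never use an edge of the cut, so both sides stay connected. -/
theorem deleteEdges {x y : V} (h : H.IsTightCut (k + 1) A) (hxy : (x, y) ∈ H.outEdges A) :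
    (H.deleteEdges {s(x, y)}).IsTightCut k A := by
  have hx := hxy.2.1
  have hy := hxy.2.2
  have hkeep : ∀ a b, (a ∈ A ↔ b ∈ A) → H.Adj a b → (H.deleteEdges {s(x, y)}).Adj a b := by
    intro a b hiff hab
    rw [deleteEdges_adj]
    refine ⟨hab, fun hmem => ?_⟩
    rcases Sym2.eq_iff.1 hmem with ⟨rfl, rfl⟩ | ⟨rfl, rfl⟩
    · exact hy (hiff.1 hx)
    · exact hy (hiff.2 hx)
  refine ⟨fun u hu v hv => (h.1 u hu v hv).of_adj_imp fun a ha b hb => hkeep a b (by tauto),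
    fun u hu v hv => (h.2 u hu v hv).of_adj_imp fun a ha b hb => hkeep a b
      ⟨fun h => absurd h ha, fun h => absurd h hb⟩, ?_⟩
  have hsub : (H.deleteEdges {s(x, y)}).outEdges A ⊆ H.outEdges A \ {(x, y)} := by
    rintro ⟨a, b⟩ ⟨hab, ha, hb⟩
    rw [deleteEdges_adj] at hab
    refine ⟨⟨hab.1, ha, hb⟩, ?_⟩
    rintro heq
    obtain ⟨rfl, rfl⟩ := Prod.mk.inj heq
    exact hab.2 rfl
  have h1 := Set.encard_sdiff_singleton_add_one hxy
  have h2 : (H.outEdges A \ {(x, y)}).encard + 1 ≤ (k : ℕ∞) + 1 := by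
    rw [h1]
    exact_mod_cast h.3
  exact (Set.encard_le_encard hsub).trans ((ENat.add_le_add_iff_right (by simp)).1 h2)

theorem exists_outEdge {W : Set V} {u v : V} (h : H.ReachableIn W u v)
    (hu : u ∈ A) (hv : v ∉ A) : ∃ p ∈ H.outEdges A, p.1 ∈ W ∧ p.2 ∈ W := by
  obtain ⟨x, y, hx, hxy, hy, hyv⟩ := h.exists_exit hu hv
  exact ⟨(x, y), ⟨hxy, hx.right_mem.2, hy⟩, hx.right_mem.1, hyv.left_mem⟩

end IsTightCut

/-- Only finitely many tight cuts of bounded size separate two given vertices. -/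
theorem finite_tightCuts (k : ℕ) : ∀ (H : SimpleGraph V) (x y : V),
    {A | H.IsTightCut k A ∧ x ∈ A ∧ y ∉ A}.Finite := by
  induction k with
  | zero =>
    intro H x y
    refine (Set.finite_singleton {w | H.Reachable x w}).subset ?_
    rintro A ⟨hA, hx, hy⟩
    have hno : H.outEdges A = ∅ := by simpa using hA.3
    ext w
    refine ⟨fun hw => (hA.1 x hx w hw).reachable, fun ⟨p⟩ => ?_⟩
    by_contra hw
    obtain ⟨q, hq, -⟩ := IsTightCut.exists_outEdge ⟨p, fun _ _ => Set.mem_univ _⟩ hx hw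
    rw [hno] at hq
    exact hq
  | succ k ih =>
    intro H x y
    by_cases hxy : H.Reachable x y
    -- Each cut contains an edge of this fixed walk and loses it when that edge is deleted. The
    -- deletion may disconnect the graph, so the induction runs over arbitrary graphs.
    · obtain ⟨p⟩ := hxy
      have hfin : (⋃ d ∈ {d | d ∈ p.darts}, {A | (H.deleteEdges {s(d.fst, d.snd)}).IsTightCut k A ∧
          d.fst ∈ A ∧ d.snd ∉ A}).Finite :=
        p.darts.finite_toSet.biUnion fun d _ => ih _ _ _
      refine hfin.subset ?_
      rintro A ⟨hA, hx, hy⟩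
      obtain ⟨d, hd, hdA, hdA'⟩ := p.exists_boundary_dart A hx hy
      exact Set.mem_biUnion hd ⟨hA.deleteEdges ⟨d.adj, hdA, hdA'⟩, hdA, hdA'⟩
    · refine (Set.finite_singleton {w | H.Reachable x w}).subset ?_
      rintro A ⟨hA, hx, hy⟩
      ext w
      refine ⟨fun hw => (hA.1 x hx w hw).reachable, fun hw => ?_⟩
      by_contra hwA
      exact hxy (hw.trans (hA.2 w hwA y hy).reachable)

/-- In a locally finite vertex-transitive graph, tight cuts of bounded size have bounded
diameter. -/
theorem exists_bound_dist_tightCut (hH : H.Connected) (hfin : ∀ v, (H.neighborSet v).Finite)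
    (htrans : ∀ u v, ∃ φ : H ≃g H, φ u = v) :
    ∃ D : ℕ → ℕ, Monotone D ∧ ∀ k A, H.IsTightCut k A → ∀ p ∈ H.outEdges A, ∀ q ∈ H.outEdges A,
      H.dist p.1 q.1 ≤ D k := by
  have hD : ∀ k, ∃ D, ∀ A, H.IsTightCut k A → ∀ p ∈ H.outEdges A, ∀ q ∈ H.outEdges A,
      H.dist p.1 q.1 ≤ D := by
    intro k
    obtain ⟨o⟩ := hH.nonempty
    have hfin1 : (⋃ y ∈ H.neighborSet o, {A | H.IsTightCut k A ∧ o ∈ A ∧ y ∉ A}).Finite :=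
      (hfin o).biUnion fun y _ => finite_tightCuts k H o y
    have hfin2 : (⋃ A ∈ ⋃ y ∈ H.neighborSet o, {A | H.IsTightCut k A ∧ o ∈ A ∧ y ∉ A},
        (fun q : V × V => H.dist o q.1) '' H.outEdges A).Finite := by
      refine hfin1.biUnion fun A hA => ?_
      simp only [Set.mem_iUnion] at hA
      obtain ⟨y, -, hA, -⟩ := hA
      exact (Set.finite_of_encard_le_coe hA.3).image _
    obtain ⟨D, hD⟩ := hfin2.bddAbove
    refine ⟨D, fun A hA p hp q hq => ?_⟩
    -- Only finitely many tight cuts of this size have an edge at `o`, and every cut with an edge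
    -- can be moved to one of them.
    obtain ⟨φ, hφ⟩ := htrans p.1 o
    rw [← hH.dist_iso φ, hφ]
    have himg : ∀ p ∈ H.outEdges A, (φ p.1, φ p.2) ∈ H.outEdges (φ '' A) := fun p hp =>
      ⟨φ.map_adj_iff.2 hp.1, ⟨p.1, hp.2.1, rfl⟩, fun ⟨w, hw, hw'⟩ =>
        hp.2.2 (φ.injective hw' ▸ hw)⟩
    have hp' := himg p hp
    rw [hφ] at hp'
    refine hD (Set.mem_biUnion (x := φ '' A) (Set.mem_biUnion (x := φ p.2) hp'.1
      ⟨hA.image φ, hp'.2.1, hp'.2.2⟩) ⟨_, himg q hq, rfl⟩)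
  choose D hD using hD
  refine ⟨fun k => (Finset.range (k + 1)).sup D, fun a b hab => Finset.sup_mono ?_,
    fun k A hA p hp q hq => (hD k A hA p hp q hq).trans (Finset.le_sup (by simp))⟩
  exact Finset.range_subset_range.2 (by omega)

theorem exists_bound_cball (hH : H.Connected) (hfin : ∀ v, (H.neighborSet v).Finite)
    (htrans : ∀ u v, ∃ φ : H ≃g H, φ u = v) :
    ∃ b : ℕ → ℕ, Monotone b ∧ ∀ v n, (H.cball v n).encard = b n := by
  obtain ⟨o⟩ := hH.nonempty
  refine ⟨fun n => (H.cball o n).ncard, fun m n hmn => Set.ncard_le_ncard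
    (fun v (hv : H.dist o v ≤ m) => hv.trans hmn) (finite_cball hH hfin o n), fun v n => ?_⟩
  obtain ⟨φ, rfl⟩ := htrans o v
  rw [← hH.image_cball, φ.injective.encard_image, (finite_cball hH hfin o n).cast_ncard_eq]

/-- A geodesic from outside `A` to a vertex of `A` enters `A` somewhere. -/
theorem Connected.exists_outEdge_geodesic (hH : H.Connected) {A : Set V} {o : V} (ho : o ∉ A)
    {a : V} (ha : a ∈ A) :
    ∃ p ∈ H.outEdges A, H.dist o p.1 + H.dist p.1 a ≤ H.dist o a := by
  induction hn : H.dist o a generalizing a with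
  | zero => exact absurd (hH.dist_eq_zero_iff.1 hn ▸ ha) ho
  | succ n ih =>
    obtain ⟨w, hwa, hw⟩ := hH.exists_adj_dist_add_one (o := o) (v := a)
      (by rintro rfl; exact ho ha)
    by_cases hwA : w ∈ A
    · obtain ⟨p, hp, hpw⟩ := ih hwA (by omega)
      have := hH.dist_le_dist_add_one p.1 hwa
      exact ⟨p, hp, by omega⟩
    · exact ⟨(a, w), ⟨hwa.symm, ha, hwA⟩, by simp [hn]⟩

variable (H) in
/-- A tight cut of size at most `k` has at most `E k` elements of `X` on one of its sides. -/
def IsInseparable (E : ℕ → ℕ) (X : Set V) : Prop :=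
  ∀ k A, H.IsTightCut k A → (A ∩ X).encard ≤ E k ∨ (Aᶜ ∩ X).encard ≤ E k

theorem encard_inter_image_iso (φ : H ≃g H) (A X : Set V) :
    (A ∩ φ '' X).encard = (φ.symm '' A ∩ X).encard := by
  rw [← φ.injective.encard_image (φ.symm '' A ∩ X), Set.image_inter φ.injective,
    ← Set.image_comp]
  congr 2
  ext x
  simp

theorem IsInseparable.image {E : ℕ → ℕ} {X : Set V} (h : H.IsInseparable E X) (φ : H ≃g H) :
    H.IsInseparable E (φ '' X) := by
  intro k A hA
  rw [encard_inter_image_iso, encard_inter_image_iso, Set.image_compl_eq φ.symm.bijective]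
  exact h k _ (hA.image φ.symm)

/-- Let `o ∉ A` and let the class meet both sides. From `a ∈ A` in the class, a walk that comes no
closer to `o` crosses the cut, so some cut edge is at least as far from `o` as `a`. A geodesic from
`o` to `a` also crosses the cut, and the two crossings are within `D k`; so `a` is within `D k` of
the cut, and the class in `A` fits in a ball of radius `2 * D k`. -/
theorem isInseparable_levelRel (hH : H.Connected) {D b : ℕ → ℕ}
    (hD : ∀ k A, H.IsTightCut k A → ∀ p ∈ H.outEdges A, ∀ q ∈ H.outEdges A, H.dist p.1 q.1 ≤ D k)
    (hb : ∀ v n, (H.cball v n).encard = b n) (o v : V) :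
    H.IsInseparable (fun k => b (2 * D k)) {w | H.LevelRel o w v} := by
  have key : ∀ k A, H.IsTightCut k A → o ∉ A →
      (A ∩ {w | H.LevelRel o w v}).encard ≤ b (2 * D k) ∨
      (Aᶜ ∩ {w | H.LevelRel o w v}).encard ≤ b (2 * D k) := by
    intro k A hA ho
    by_cases hsub : ∃ c ∈ Aᶜ, H.LevelRel o c v
    · left
      obtain ⟨c, hcA, hc⟩ := hsub
      rcases (A ∩ {w | H.LevelRel o w v}).eq_empty_or_nonempty with hemp | ⟨a₀, ha₀, -⟩
      · simp [hemp]
      obtain ⟨p₀, hp₀, -⟩ := hH.exists_outEdge_geodesic ho ha₀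
      rw [← hb p₀.1]
      refine Set.encard_le_encard ?_
      rintro a ⟨ha, hav⟩
      have hac : H.LevelRel o a c := (H.levelSetoid o).trans hav ((H.levelSetoid o).symm hc)
      obtain ⟨p, hp, hpn, -⟩ := IsTightCut.exists_outEdge hac.2 ha hcA
      obtain ⟨q, hq, hqa⟩ := hH.exists_outEdge_geodesic ho ha
      have h1 := hD k A hA p₀ hp₀ q hq
      have h2 := hD k A hA q hq p hp
      have h3 := hH.dist_triangle (u := o) (v := q.1) (w := p.1)
      have h4 := hH.dist_triangle (u := p₀.1) (v := q.1) (w := a)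
      have h5 : H.dist o a ≤ H.dist o p.1 := hpn
      show H.dist p₀.1 a ≤ 2 * D k
      omega
    · right
      push Not at hsub
      have : Aᶜ ∩ {w | H.LevelRel o w v} = ∅ :=
        Set.eq_empty_of_forall_notMem fun w hw => hsub w hw.1 hw.2
      simp [this]
  intro k A hA
  by_cases ho : o ∈ A
  · simpa using (key k Aᶜ hA.compl (by simpa using ho)).symm
  · exact key k A hA ho

end SimpleGraph

/-! ### Centres of inseparable sets. -/

namespace SimpleGraph

universe u

variable {V : Type u} {H : SimpleGraph V} {D E : ℕ → ℕ} {X : Set V} {k : ℕ}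

variable (H) in
/-- A tight cut of size at most `k`, of which `A` is the side with few elements of `X`. -/
def IsSmallSide (E : ℕ → ℕ) (X : Set V) (k : ℕ) (A : Set V) : Prop :=
  H.IsTightCut k A ∧ (A ∩ X).encard ≤ E k

theorem IsSmallSide.mono {A : Set V} {l : ℕ} (hE : Monotone E) (h : H.IsSmallSide E X k A)
    (hkl : k ≤ l) : H.IsSmallSide E X l A :=
  ⟨h.1.mono hkl, h.2.trans (by exact_mod_cast hE hkl)⟩

theorem Connected.exists_outEdge_of_cball (hH : H.Connected) {A : Set V} {v w : V} {r : ℕ}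
    (hA : H.cball v r ⊆ A) (hw : H.dist v w ≤ r + 1) (hwA : w ∉ A) :
    ∃ x, (x, w) ∈ H.outEdges A := by
  have hwv : w ≠ v := by
    rintro rfl
    exact hwA (hA (by simp [cball]))
  obtain ⟨x, hx, hxw⟩ := hH.exists_adj_dist_add_one hwv
  exact ⟨x, hx, hA (show H.dist v x ≤ r by omega), hwA⟩

/-- If the small side `A'` contains a large ball about a vertex next to the small side `A`, then
it contains a larger ball about `v` than `A`. -/
theorem IsSmallSide.cball_subset (hH : H.Connected)
    (hD : ∀ k A, H.IsTightCut k A → ∀ p ∈ H.outEdges A, ∀ q ∈ H.outEdges A, H.dist p.1 q.1 ≤ D k)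
    (hX : (2 * E k : ℕ) < X.encard) {A A' : Set V} (hA : H.IsSmallSide E X k A)
    (hA' : H.IsSmallSide E X k A') {p : V × V} (hp : p ∈ H.outEdges A)
    (hpA' : H.cball p.2 (3 * D k + 3) ⊆ A') {v : V} {r : ℕ} (hr : H.cball v r ⊆ A) :
    H.cball v (r + 1) ⊆ A' := by
  have hnear : ∀ q ∈ H.outEdges A, H.dist p.2 q.1 ≤ D k + 1 := by
    intro q hq
    have h1 := hD k A hA.1 p hp q hq
    have h2 := hH.dist_triangle (u := p.2) (v := p.1) (w := q.1)
    have h3 : H.dist p.2 p.1 ≤ 1 := H.dist_le hp.1.symm.toWalk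
    omega
  have hfar : ∀ q ∈ H.outEdges A', ∀ p' ∈ H.outEdges A, 2 * D k + 2 ≤ H.dist q.1 p'.1 := by
    intro q hq p' hp'
    have h1 : ¬ H.dist p.2 q.2 ≤ 3 * D k + 3 := fun h => hq.2.2 (hpA' h)
    have h2 := hH.dist_le_dist_add_one p.2 hq.1
    have h3 := hH.dist_triangle (u := p.2) (v := p'.1) (w := q.1)
    have h4 := hnear p' hp'
    rw [H.dist_comm (u := p'.1)] at h3
    omega
  -- A geodesic between cut edges of `A'` on different sides of `A` has length at most `D k`, but
  -- would pass a cut edge of `A`, which is at distance at least `2 * D k + 2`.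
  have hside : (∀ q ∈ H.outEdges A', q.1 ∉ A) ∨ ∀ q ∈ H.outEdges A', q.1 ∈ A := by
    by_contra! hcon
    obtain ⟨⟨q, hq, hqA⟩, q', hq', hqA'⟩ := hcon
    obtain ⟨p', hp', hdist⟩ := hH.exists_outEdge_geodesic hqA' hqA
    have h1 := hD k A' hA'.1 q' hq' q hq
    have h2 := hfar q' hq' p' hp'
    omega
  have hpmem : ∀ w, H.dist p.2 w ≤ D k + 2 → w ∈ A' := fun w hw =>
    hpA' (show H.dist p.2 w ≤ 3 * D k + 3 by omega)
  rcases hside with hside | hside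
  · have hAA' : A ⊆ A' := by
      intro a ha
      by_contra haA'
      obtain ⟨q, hq, hqA, -⟩ := IsTightCut.exists_outEdge (hA.1.1 p.1 hp.2.1 a ha)
        (hpmem p.1 ((hnear p hp).trans (by omega))) haA'
      exact hside q hq hqA
    intro w hw
    by_cases hwA : w ∈ A
    · exact hAA' hwA
    obtain ⟨x, hx⟩ := hH.exists_outEdge_of_cball hr hw hwA
    refine hpmem w ((hH.dist_le_dist_add_one p.2 hx.1).trans ?_)
    have := hnear _ hx
    simpa using this
  -- Here the two small sides cover everything, so `X` would have at most `2 * E k` elements.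
  · exfalso
    have hAA' : Aᶜ ⊆ A' := by
      intro a ha
      by_contra haA'
      obtain ⟨q, hq, hqA, -⟩ := IsTightCut.exists_outEdge (hA.1.2 p.2 hp.2.2 a ha)
        (hpmem p.2 (by simp)) haA'
      exact hqA (hside q hq)
    refine absurd hX (not_lt.2 ?_)
    calc X.encard ≤ ((A ∩ X) ∪ (A' ∩ X)).encard := by
          refine Set.encard_le_encard fun x hx => ?_
          by_cases hxA : x ∈ A
          · exact Or.inl ⟨hxA, hx⟩
          · exact Or.inr ⟨hAA' hxA, hx⟩
      _ ≤ (A ∩ X).encard + (A' ∩ X).encard := Set.encard_union_le _ _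
      _ ≤ (E k : ℕ∞) + E k := add_le_add hA.2 hA'.2
      _ = ((2 * E k : ℕ) : ℕ∞) := by rw [two_mul, Nat.cast_add]

/-- Grow the ball about `v` until no small side contains it. If radius `3 * D k + 3` does not
suffice, the last ball lies in a small side `A`, and a vertex `v'` of the next ball outside `A`
works: by `IsSmallSide.cball_subset`, a small side containing the ball about `v'` would contain that
next ball. -/
theorem exists_center_step (hH : H.Connected)
    (hD : ∀ k A, H.IsTightCut k A → ∀ p ∈ H.outEdges A, ∀ q ∈ H.outEdges A, H.dist p.1 q.1 ≤ D k)
    (hX : (2 * E k : ℕ) < X.encard) (v : V) (ρ : ℕ)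
    (hρ : ∀ A, H.IsSmallSide E X k A → ¬ H.cball v ρ ⊆ A) :
    ∃ v', H.dist v v' ≤ ρ ∧ ∀ A, H.IsSmallSide E X k A → ¬ H.cball v' (3 * D k + 3) ⊆ A := by
  classical
  by_cases hv : ∀ A, H.IsSmallSide E X k A → ¬ H.cball v (3 * D k + 3) ⊆ A
  · exact ⟨v, by simp, hv⟩
  push Not at hv
  obtain ⟨A₀, hA₀, hv₀⟩ := hv
  have hex : ∃ n, ∀ A, H.IsSmallSide E X k A → ¬ H.cball v n ⊆ A := ⟨ρ, hρ⟩
  obtain ⟨m, hm⟩ : ∃ m, Nat.find hex = m + 1 := by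
    refine Nat.exists_eq_succ_of_ne_zero fun h0 => ?_
    refine Nat.find_spec hex A₀ hA₀ (Set.Subset.trans (fun w hw => ?_) hv₀)
    rw [h0] at hw
    exact Nat.le_trans hw (Nat.zero_le _)
  have hnot : ∃ A, H.IsSmallSide E X k A ∧ H.cball v m ⊆ A := by
    have := Nat.find_min hex (m := m) (by omega)
    push Not at this
    exact this
  obtain ⟨A, hA, hvA⟩ := hnot
  have hspec := Nat.find_spec hex
  have hmρ : m + 1 ≤ ρ := hm ▸ Nat.find_min' hex hρ
  rw [hm] at hspec
  obtain ⟨w, hw, hwA⟩ := Set.not_subset.1 (hspec A hA)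
  obtain ⟨x, hx⟩ := hH.exists_outEdge_of_cball hvA hw hwA
  exact ⟨w, Nat.le_trans hw hmρ, fun A' hA' hwA' =>
    hspec A' hA' (hA.cball_subset hH hD hX hA' hx hwA' hvA)⟩

/-- The radius up to which the centre of an inseparable set is protected against cuts of size
`j`. -/
def centerRadius (D : ℕ → ℕ) (j : ℕ) : ℕ :=
  3 * D j + 3 + ∑ i ∈ Finset.range (j + 1), (3 * D i + 3)

/-- Descend from `k` to `0`, recentring for each size. As small sides of size `k` are also small
sides of size `k + 1`, each move is at most `3 * D (k + 1) + 3`, and the sum in `centerRadius`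
absorbs all later moves. -/
theorem exists_center_of_le (hH : H.Connected)
    (hD : ∀ k A, H.IsTightCut k A → ∀ p ∈ H.outEdges A, ∀ q ∈ H.outEdges A, H.dist p.1 q.1 ≤ D k)
    (hE : Monotone E) (hX : (2 * E k : ℕ) < X.encard) (v : V)
    (hv : ∀ A, H.IsSmallSide E X k A → ¬ H.cball v (3 * D k + 3) ⊆ A) :
    ∃ w, H.dist v w ≤ ∑ i ∈ Finset.range (k + 1), (3 * D i + 3) ∧
      ∀ j ≤ k, ∀ A, H.IsSmallSide E X j A → ¬ H.cball w (centerRadius D j) ⊆ A := by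
  have hball : ∀ {j : ℕ} {v w : V},
      H.dist v w ≤ ∑ i ∈ Finset.range (j + 1), (3 * D i + 3) →
      H.cball v (3 * D j + 3) ⊆ H.cball w (centerRadius D j) := by
    intro j v w hvw x hx
    have h1 := hH.dist_triangle (u := w) (v := v) (w := x)
    have h2 : H.dist v x ≤ 3 * D j + 3 := hx
    rw [H.dist_comm (u := w) (v := v)] at h1
    show H.dist w x ≤ centerRadius D j
    unfold centerRadius
    omega
  induction k generalizing v with
  | zero =>
    refine ⟨v, by simp, fun j hj A hA hvA => ?_⟩
    obtain rfl := Nat.le_zero.1 hj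
    exact hv A hA ((hball (by simp)).trans hvA)
  | succ k ih =>
    have hXk : (2 * E k : ℕ) < X.encard :=
      lt_of_le_of_lt (by exact_mod_cast Nat.mul_le_mul_left 2 (hE (Nat.le_succ k))) hX
    obtain ⟨v', hvv', hv'⟩ := exists_center_step hH hD hXk v (3 * D (k + 1) + 3)
      fun A hA => hv A (hA.mono hE (Nat.le_succ k))
    obtain ⟨w, hw, hwj⟩ := ih hXk v' hv'
    have hvw : H.dist v w ≤ ∑ i ∈ Finset.range (k + 1 + 1), (3 * D i + 3) := by
      have := hH.dist_triangle (u := v) (v := v') (w := w)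
      rw [Finset.sum_range_succ]
      omega
    refine ⟨w, hvw, fun j hj A hA hwA => ?_⟩
    rcases Nat.lt_or_eq_of_le hj with hj | rfl
    · exact hwj j (by omega) A hA hwA
    · exact hv A hA ((hball hvw).trans hwA)

/-- Every large inseparable set has a centre: a vertex such that no ball of controlled radius
about it is cut off from that set by few edges. -/
theorem exists_center (hH : H.Connected)
    (hD : ∀ k A, H.IsTightCut k A → ∀ p ∈ H.outEdges A, ∀ q ∈ H.outEdges A, H.dist p.1 q.1 ≤ D k)
    (hE : Monotone E) (hfin : X.Finite) (hX : (2 * E k : ℕ) < X.encard) :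
    ∃ w, ∀ j ≤ k, ∀ A, H.IsSmallSide E X j A → ¬ H.cball w (centerRadius D j) ⊆ A := by
  obtain ⟨v⟩ := hH.nonempty
  obtain ⟨ρ, hρ⟩ := (hfin.image (H.dist v)).bddAbove
  -- A ball containing all of `X` lies in no small side, so some starting radius is available.
  obtain ⟨v', -, hv'⟩ := exists_center_step hH hD hX v ρ fun A hA hvA => by
    have hXA : A ∩ X = X := Set.inter_eq_right.2 fun x hx => hvA (hρ ⟨x, hx, rfl⟩)
    have h1 := hA.2
    rw [hXA] at h1
    refine absurd (hX.trans_le h1) (not_lt.2 ?_)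
    exact_mod_cast Nat.le_mul_of_pos_left _ two_pos
  obtain ⟨w, -, hw⟩ := exists_center_of_le hH hD hE hX v' hv'
  exact ⟨w, hw⟩

end SimpleGraph

/-! ### The direction given by large classes. -/

namespace SimpleGraph

universe u

variable {V : Type u} {H : SimpleGraph V}

theorem Connected.reachableIn_cball (hH : H.Connected) {o v : V} {n : ℕ} (hv : v ∈ H.cball o n) :
    H.ReachableIn (H.cball o n) o v := by
  induction n generalizing v with
  | zero =>
    obtain rfl : o = v := hH.dist_eq_zero_iff.1 (Nat.le_zero.1 hv)
    exact .refl hv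
  | succ n ih =>
    by_cases hvo : v = o
    · subst hvo
      exact .refl hv
    obtain ⟨w, hw, hwv⟩ := hH.exists_adj_dist_add_one hvo
    have hv' : H.dist o v ≤ n + 1 := hv
    have hsub : H.cball o n ⊆ H.cball o (n + 1) := fun x (hx : H.dist o x ≤ n) =>
      (Nat.le_succ_of_le hx : H.dist o x ≤ n + 1)
    have := (ih (show H.dist o w ≤ n by omega)).mono hsub
    exact this.trans (.of_adj hw this.right_mem hv)

/-- If a tail avoids a ball, then it is cut off from this ball by a tight cut. -/
theorem exists_tightCut_of_disjoint_tail (hH : H.Connected)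
    (hfin : ∀ v, (H.neighborSet v).Finite) {𝒲 : Ultrafilter V} (h𝒲 : ∀ s ∈ 𝒲, s.Infinite)
    {d : ℕ} (hd : ∀ v, (H.cball v 1).encard = d) {T : Finset V} {o : V} {r : ℕ}
    (hT : Disjoint (H.tail 𝒲 T) (H.cball o r)) :
    ∃ Y, H.IsTightCut (T.card * d) Y ∧ H.cball o r ⊆ Y ∧ H.tail 𝒲 T ⊆ Yᶜ := by
  classical
  -- The component of `o` off the tail: what is left is connected through the tail, and every edge
  -- leaving `Y` runs from `T` into the tail.
  set Y : Set V := {y | H.ReachableIn (H.tail 𝒲 T)ᶜ o y} with hY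
  have hball : H.cball o r ⊆ Y := fun v hv =>
    (hH.reachableIn_cball hv).mono fun x hx hx' => Set.disjoint_left.1 hT hx' hx
  have htail : H.tail 𝒲 T ⊆ Yᶜ := fun v hv hvY => hvY.right_mem hv
  have htail_ne : (H.tail 𝒲 T).Nonempty :=
    𝒲.nonempty_of_mem (tail_mem hH hfin h𝒲 T.finite_toSet)
  have htoTail : ∀ u ∈ Yᶜ, ∃ t ∈ H.tail 𝒲 T, H.ReachableIn Yᶜ u t := by
    intro u hu
    by_cases hut : u ∈ H.tail 𝒲 T
    · exact ⟨u, hut, .refl hu⟩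
    obtain ⟨x, t, ht, htx, hux⟩ := hH.exists_adj_of_notMem htail_ne hut
    have hux' : H.ReachableIn Yᶜ u x :=
      hux.within.mono fun z hz hzY => hu (hzY.trans (ReachableIn.symm hz))
    exact ⟨t, ht, hux'.trans (.of_adj htx.symm hux'.right_mem (htail ht))⟩
  refine ⟨Y, ⟨fun u hu v hv => ?_, fun u hu v hv => ?_, ?_⟩, hball, htail⟩
  · exact (hu.symm.trans hv).within.mono fun z hz => hu.trans hz
  · obtain ⟨s, hs, hus⟩ := htoTail u hu
    obtain ⟨t, ht, hvt⟩ := htoTail v hv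
    exact (hus.trans ((reachableIn_tail hs ht).mono htail)).trans hvt.symm
  · have hsub : H.outEdges Y ⊆ (T.biUnion fun t =>
        (finite_cball hH hfin t 1).toFinset.image fun a => (t, a) : Finset (V × V)) := by
      rintro ⟨y, a⟩ ⟨hya, hy, ha⟩
      have hatail : a ∈ H.tail 𝒲 T := by
        by_contra hat
        exact ha (ReachableIn.trans hy (.of_adj hya hy.right_mem hat))
      have hyT : y ∈ T := by
        by_contra hyT
        exact hy.right_mem (mem_tail_of_adj hatail hya.symm hyT)
      have hya1 : a ∈ H.cball y 1 := H.dist_le hya.toWalk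
      simpa using And.intro hya1 hyT
    refine (Set.encard_le_encard hsub).trans ?_
    rw [Set.encard_coe_eq_coe_finsetCard, Nat.cast_le]
    refine Finset.card_biUnion_le_card_mul _ _ _ fun t _ => Finset.card_image_le.trans ?_
    have := hd t
    rw [(finite_cball hH hfin t 1).encard_eq_coe_toFinset_card] at this
    exact (Nat.cast_injective this).le

/-- Larger and larger sets have an ultrafilter of accumulation. -/
theorem exists_ultrafilter_of_encard (X : ℕ → Set V) (hX : ∀ k : ℕ, (k : ℕ∞) < (X k).encard) :
    ∃ 𝒲 : Ultrafilter V, ∀ s ∈ 𝒲, ∀ e : ℕ, ∃ k ≥ e, (e : ℕ∞) < (s ∩ X k).encard := by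
  -- The sets with eventually bounded trace on the `X k` form a proper ideal; the ultrafilter
  -- extends the dual filter.
  let P : Set V → Prop := fun s => ∃ e : ℕ, ∀ k ≥ e, (s ∩ X k).encard ≤ e
  let F : Filter V := Filter.comk P ⟨0, fun k _ => by simp⟩
    (fun t ⟨e, he⟩ s hst => ⟨e, fun k hk =>
      (Set.encard_le_encard (Set.inter_subset_inter_left _ hst)).trans (he k hk)⟩)
    (fun s ⟨e, he⟩ t ⟨f, hf⟩ => ⟨e + f, fun k hk => by
      rw [Set.union_inter_distrib_right, Nat.cast_add]
      exact (Set.encard_union_le _ _).trans (add_le_add (he k (by omega)) (hf k (by omega)))⟩)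
  have hF : F.NeBot := by
    refine ⟨fun hbot => ?_⟩
    have : (∅ : Set V) ∈ F := by
      rw [hbot]
      exact Filter.mem_bot
    obtain ⟨e, he⟩ := Filter.mem_comk.1 this
    have := he e le_rfl
    rw [Set.compl_empty, Set.univ_inter] at this
    exact absurd (hX e) (not_lt.2 this)
  refine ⟨Ultrafilter.of F, fun s hs => ?_⟩
  by_contra! hcon
  have hsc : sᶜ ∈ Ultrafilter.of F := Ultrafilter.of_le F (Filter.compl_mem_comk.2 hcon)
  exact Ultrafilter.compl_notMem_iff.2 hs hsc

/-- A connected, locally finite, vertex-transitive graph without finite tree-width has a thick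
end. -/
theorem hasThickEnd_of_not_hasFiniteTreeWidth (hH : H.Connected)
    (hfin : ∀ v, (H.neighborSet v).Finite) (htrans : ∀ u v, ∃ φ : H ≃g H, φ u = v)
    (htw : ¬ H.HasFiniteTreeWidth) : H.HasThickEnd := by
  classical
  obtain ⟨o⟩ := hH.nonempty
  obtain ⟨D, hDmono, hD⟩ := exists_bound_dist_tightCut hH hfin htrans
  obtain ⟨b, hbmono, hb⟩ := exists_bound_cball hH hfin htrans
  set E : ℕ → ℕ := fun k => b (2 * D k) with hEdef
  have hE : Monotone E := fun i j hij => hbmono (Nat.mul_le_mul_left 2 (hDmono hij))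
  have hlarge : ∀ k : ℕ, ∃ X : Set V, (k : ℕ∞) < X.encard ∧ H.IsInseparable E X ∧
      ∀ j ≤ k, ∀ A, H.IsSmallSide E X j A → ¬ H.cball o (centerRadius D j) ⊆ A := by
    intro k
    -- The bound `k` serves the ultrafilter, and `2 * E k` the existence of a centre.
    obtain ⟨v, hv⟩ : ∃ v, ((max k (2 * E k) : ℕ) : ℕ∞) < {w | H.LevelRel o w v}.encard := by
      by_contra! hcon
      exact htw (hasFiniteTreeWidth_of_levelRel hH o _ hcon)
    have hvfin : {w | H.LevelRel o w v}.Finite :=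
      (finite_cball hH hfin o (H.dist o v)).subset fun w hw => hw.1.le
    obtain ⟨w, hw⟩ := exists_center (E := E) (k := k) hH hD hE hvfin
      (lt_of_le_of_lt (by exact_mod_cast le_max_right _ _) hv)
    obtain ⟨φ, hφ⟩ := htrans w o
    refine ⟨φ '' {w | H.LevelRel o w v}, ?_, (isInseparable_levelRel hH hD hb o v).image φ,
      fun j hj A hA hoA => ?_⟩
    · rw [φ.injective.encard_image]
      exact lt_of_le_of_lt (by exact_mod_cast le_max_left _ _) hv
    · refine hw j hj (φ.symm '' A) ⟨hA.1.image φ.symm, ?_⟩ ?_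
      · rw [← encard_inter_image_iso]
        exact hA.2
      · have hw' : φ.symm o = w := by rw [← hφ, φ.symm_apply_apply]
        rw [← hw', ← hH.image_cball]
        exact Set.image_mono hoA
  choose X hXcard hXins hXcenter using hlarge
  obtain ⟨𝒲, h𝒲⟩ := exists_ultrafilter_of_encard X hXcard
  have h𝒲inf : ∀ s ∈ 𝒲, s.Infinite := by
    intro s hs hsfin
    obtain ⟨k, -, hk⟩ := h𝒲 s hs s.ncard
    rw [hsfin.cast_ncard_eq] at hk
    exact absurd (Set.encard_le_encard Set.inter_subset_left) (not_le.2 hk)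
  refine hasThickEnd_of_ultrafilter hH hfin h𝒲inf fun m => ?_
  set j := m * b 1 with hj
  refine ⟨(finite_cball hH hfin o (centerRadius D j)).toFinset, fun T hT => ?_⟩
  by_contra! hTm
  rw [Set.Finite.coe_toFinset] at hT
  obtain ⟨Y, hY, hoY, hYT⟩ := exists_tightCut_of_disjoint_tail hH hfin h𝒲inf
    (fun v => hb v 1) hT
  have hYj : H.IsTightCut j Y := hY.mono (Nat.mul_le_mul_right _ hTm)
  have hYc : Yᶜ ∈ 𝒲 := Filter.mem_of_superset (tail_mem hH hfin h𝒲inf T.finite_toSet) hYT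
  -- With `k ≥ j` the vertex `o` is a centre of `X k` for cuts of size `j`; more than `E j` elements
  -- of `X k` in `Yᶜ` make `Y` the small side.
  obtain ⟨k, hk, hkY⟩ := h𝒲 _ hYc (max j (E j))
  rcases hXins k j Y hYj with h | h
  · exact hXcenter k j ((le_max_left _ _).trans hk) Y ⟨hYj, h⟩ hoY
  · refine absurd (hkY.trans_le h) (not_lt.2 ?_)
    exact_mod_cast le_max_right _ _

/-! ### Cayley graphs are connected, locally finite and vertex-transitive. -/

section Cayley

variable {G : Type u} [Group G] {S : Set G}

theorem connected_mulCayley (hS : Subgroup.closure S = ⊤) : (mulCayley S).Connected := by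
  have hstep : ∀ x : G, ∀ s ∈ S, (mulCayley S).Reachable x (x * s) := by
    intro x s hs
    by_cases hxs : x = x * s
    · rw [← hxs]
    · exact Adj.reachable ((mulCayley_adj S _ _).2 ⟨hxs, Or.inl (by simpa using hs)⟩)
  have hone : ∀ g : G, (mulCayley S).Reachable 1 g := by
    intro g
    have hg : g ∈ Subgroup.closure S := by
      rw [hS]
      trivial
    induction hg using Subgroup.closure_induction_right with
    | one => exact Reachable.refl _
    | mul_right x _ y hy ih => exact ih.trans (hstep x y hy)
    | mul_inv_cancel x _ y hy ih =>
      refine ih.trans ?_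
      simpa using (hstep (x * y⁻¹) y hy).symm
  have : Nonempty G := ⟨1⟩
  exact Connected.mk fun a b => (hone a).symm.trans (hone b)

theorem finite_neighborSet_mulCayley (hS : S.Finite) (v : G) :
    ((mulCayley S).neighborSet v).Finite := by
  refine ((hS.image (v * ·)).union (hS.image fun s => v * s⁻¹)).subset fun w hw => ?_
  rcases ((mulCayley_adj S v w).1 hw).2 with h | h
  · exact Or.inl ⟨_, h, by simp⟩
  · exact Or.inr ⟨_, h, by simp⟩

theorem exists_iso_mulCayley (S : Set G) (u v : G) :
    ∃ φ : mulCayley S ≃g mulCayley S, φ u = v :=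
  ⟨⟨Equiv.mulLeft (v * u⁻¹), by simp⟩, by simp⟩

end Cayley

end SimpleGraph

theorem lemma2p1 (G : Type*) [Group G] [Group.FG G] :
    (∀ S : Set G, S.Finite → Subgroup.closure S = ⊤ →
      ¬ (SimpleGraph.mulCayley S).HasFiniteTreeWidth → (SimpleGraph.mulCayley S).HasThickEnd) ∧
    (¬ GroupHasFiniteTreeWidth G → GroupHasThickEnd G) := by
  have key : ∀ S : Set G, S.Finite → Subgroup.closure S = ⊤ →
      ¬ (SimpleGraph.mulCayley S).HasFiniteTreeWidth →
      (SimpleGraph.mulCayley S).HasThickEnd := fun S hfin hS =>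
    SimpleGraph.hasThickEnd_of_not_hasFiniteTreeWidth (SimpleGraph.connected_mulCayley hS)
      (SimpleGraph.finite_neighborSet_mulCayley hfin) (SimpleGraph.exists_iso_mulCayley S)
  refine ⟨key, fun h => ?_⟩
  unfold GroupHasFiniteTreeWidth at h
  push Not at h
  obtain ⟨S, hfin, hS, htw⟩ := h
  exact ⟨S, hfin, hS, key S hfin hS htw⟩
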